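/- Let $G$ be a finitely generated group which is torsion-free and commutative transitive (commutation is a transitive relation on $G\setminus\{1\}$). Let $\mathcal E$ be the class of infinite cyclic subgroups of $G$ and let $\sim$ be commensurability. A $G$-tree is a simplicial tree on which $G$ acts without inversions; an $\mathcal E$-tree is a $G$-tree whose edge stabilizers lie in $\mathcal E$; a subgroup is elliptic if it fixes a point; $T$ dominates $T'$ if there is an equivariant map $T\to T'$; two $G$-trees are in the same deformation space if they have the same elliptic subgroups; a $G$-tree is $k$-acylindrical if every segment of length $>k$ has trivial stabilizer, and acylindrical if it is $k$-acylindrical for some $k$. For $s\neq 0$ let $BS(1,s)=\langle a,t\mid tat^{-1}=a^s\rangle$. Let $T$ be an $\mathcal E$-tree which is not reduced to a point. Its cylinders are the equivalence classes of edges for the relation $G_e\sim G_{e'}$, a cylinder being identified with the union of its edges. Let $T_c$ be the tree of cylinders: its vertices are the vertices of $T$ belonging to at least two cylinders, together with the cylinders of $T$, and a vertex $x$ of the first kind is joined by an edge to a cylinder $Y$ if and only if $x\in Y$. Let $T_c^*$ be obtained from $T_c$ by collapsing all edges whose stabilizer is not in $\mathcal E$. Then $T_c$ is a $G$-tree, $T_c^*$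 is an $\mathcal E$-tree, and: 1. $T_c^*$ and $T_c$ are in the same deformation space. 2. Every non-cyclic vertex stabilizer of $T$ is a vertex stabilizer of $T_c$ and of $T_c^*$, and every other non-cyclic vertex stabilizer of $T_c^*$ is isomorphic to some $BS(1,s)$ with $s\ne0$. Every subgroup of $G$ isomorphic to some $BS(1,s)$ with $s\neq 0$ is elliptic in $T_c$ and in $T_c^*$. Moreover $T_c$ is in the same deformation space as $T$ if and only if every subgroup of $G$ isomorphic to some $BS(1,s)$, $s\neq0$, is elliptic in $T$, and the same equivalence holds for $T_c^*$. In particular, if all these subgroups are elliptic in $T$, then $T_c^*$, $T_c$ and $T$ lie in the same deformation space. 3. $T_c^*$ is $2$-acylindrical, and it dominates every acylindrical $\mathcal E$-tree that $T$ dominates. -/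

import Mathlib

open Pointwise

universe u v w

/-- A simplicial graph together with an action of the group `G` by graph automorphisms. -/
structure ActionGraph (G : Type u) [Group G] where
  /-- the vertices -/
  V : Type v
  /-- the action of `G` on vertices -/
  [action : MulAction G V]
  /-- the graph -/
  graph : SimpleGraph V
  smul_adj : ∀ (g : G) {x y : V}, graph.Adj x y → graph.Adj (g • x) (g • y)

attribute [instance] ActionGraph.action

/-- The infinite cyclic subgroups: the class of allowed edge stabilizers. -/
def IsInfiniteCyclic {G : Type u} [Group G] (H : Subgroup G) : Prop :=
  IsCyclic H ∧ Infinite H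

theorem isInfiniteCyclic_conj {G : Type u} [Group G] (g : ConjAct G) {H : Subgroup G}
    (h : IsInfiniteCyclic H) : IsInfiniteCyclic (g • H) := by
  obtain ⟨h₁, h₂⟩ := h
  have e : H ≃* (g • H : Subgroup G) := Subgroup.equivSMul g H
  exact ⟨isCyclic_of_surjective e e.surjective, Infinite.of_injective e e.injective⟩

theorem isInfiniteCyclic_conj_iff {G : Type u} [Group G] (g : ConjAct G) {H : Subgroup G} :
    IsInfiniteCyclic (g • H) ↔ IsInfiniteCyclic H :=
  ⟨fun h => by simpa using isInfiniteCyclic_conj g⁻¹ h, isInfiniteCyclic_conj g⟩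

namespace ActionGraph

variable {G : Type u} [Group G]

/-- The action is without inversions: no element exchanges the endpoints of an edge. -/
def WithoutInversions (T : ActionGraph.{u, v} G) : Prop :=
  ∀ (g : G) (x y : T.V), T.graph.Adj x y → ¬ (g • x = y ∧ g • y = x)

/-- A `G`-tree: a simplicial tree on which `G` acts without inversions. -/
def IsGTree (T : ActionGraph.{u, v} G) : Prop :=
  T.graph.IsTree ∧ T.WithoutInversions

/-- The stabilizer `G_x` of a vertex. -/
abbrev vertexStab (T : ActionGraph.{u, v} G) (x : T.V) : Subgroup G :=
  MulAction.stabilizer G x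

/-- The stabilizer `G_e` of an edge `e`: the elements fixing both endpoints. As there are no
inversions in a `G`-tree, every element leaving `e` invariant fixes its endpoints. -/
def edgeStab (T : ActionGraph.{u, v} G) (e : Sym2 T.V) : Subgroup G :=
  fixingSubgroup G (e : Set T.V)

/-- A `G`-tree with infinite cyclic edge stabilizers. -/
def IsCyclicTree (T : ActionGraph.{u, v} G) : Prop :=
  T.IsGTree ∧ ∀ e ∈ T.graph.edgeSet, IsInfiniteCyclic (T.edgeStab e)

/-- A subgroup is elliptic if it has a global fixed point. (In a `G`-tree, which has no
inversions, a subgroup with a fixed point in the geometric realization fixes a vertex.) -/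
def IsElliptic (T : ActionGraph.{u, v} G) (H : Subgroup G) : Prop :=
  ∃ x : T.V, ∀ g ∈ H, g • x = x

/-- `T` dominates `T'`: there is an equivariant map from `T` to `T'`. For `G`-trees, an
equivariant map on vertices extends uniquely to an equivariant map sending each edge to the
(possibly trivial) edge path without backtracking between the images of its endpoints. -/
def Dominates (T : ActionGraph.{u, v} G) (T' : ActionGraph.{u, w} G) : Prop :=
  ∃ f : T.V → T'.V, ∀ (g : G) (x : T.V), f (g • x) = g • f x

/-- Two `G`-trees are in the same deformation space if they have the same elliptic subgroups. -/
def SameDeformationSpace (T : ActionGraph.{u, v} G) (T' : ActionGraph.{u, w} G) : Prop :=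
  ∀ H : Subgroup G, T.IsElliptic H ↔ T'.IsElliptic H

/-- `k`-acylindricity of a `G`-tree: the (pointwise) stabilizer of any segment of length `> k` is
trivial. In a tree, fixing a segment is the same as fixing its two endpoints. -/
def IsAcylindricalWith (T : ActionGraph.{u, v} G) (k : ℕ) : Prop :=
  ∀ x y : T.V, k < T.graph.dist x y → ∀ g : G, g • x = x → g • y = y → g = 1

/-- Acylindricity: `k`-acylindricity for some `k`. -/
def IsAcylindrical (T : ActionGraph.{u, v} G) : Prop :=
  ∃ k : ℕ, T.IsAcylindricalWith k

/-! ### Cylinders -/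

/-- The action of `g` on unordered pairs of vertices preserves edges. -/
theorem map_mem_edgeSet (T : ActionGraph.{u, v} G) (g : G) {e : Sym2 T.V}
    (he : e ∈ T.graph.edgeSet) : e.map (g • ·) ∈ T.graph.edgeSet := by
  induction e with
  | h x y =>
    rw [Sym2.map_mk, SimpleGraph.mem_edgeSet]
    exact T.smul_adj g he

/-- `G` acts on the (non-oriented) edges. -/
instance edgeAction (T : ActionGraph.{u, v} G) : MulAction G T.graph.edgeSet where
  smul g e := ⟨e.1.map (g • ·), T.map_mem_edgeSet g e.2⟩
  one_smul e := Subtype.ext <| by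
    change e.1.map (fun x => (1 : G) • x) = e.1
    simp only [one_smul]
    exact congrFun Sym2.map_id' e.1
  mul_smul g h e := Subtype.ext <| by
    change e.1.map (fun x => (g * h) • x) = (e.1.map (h • ·)).map (g • ·)
    rw [Sym2.map_map]
    congr 1
    funext x
    exact mul_smul g h x

theorem edge_smul_val (T : ActionGraph.{u, v} G) (g : G) (e : T.graph.edgeSet) :
    (g • e).1 = e.1.map (g • ·) := rfl

theorem edgeStab_map (T : ActionGraph.{u, v} G) (g : G) (e : Sym2 T.V) :
    T.edgeStab (e.map (g • ·)) = ConjAct.toConjAct g • T.edgeStab e := by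
  ext h
  rw [Subgroup.mem_pointwise_smul_iff_inv_smul_mem, ← ConjAct.toConjAct_inv,
    ConjAct.toConjAct_smul]
  simp only [edgeStab, mem_fixingSubgroup_iff, SetLike.mem_coe, Sym2.mem_map,
    forall_exists_index, and_imp, forall_apply_eq_imp_iff₂, inv_inv, mul_smul,
    inv_smul_eq_iff]

/-- Two edges are equivalent if their stabilizers are commensurable. -/
def cylinderSetoid (T : ActionGraph.{u, v} G) : Setoid T.graph.edgeSet where
  r e e' := Subgroup.Commensurable (T.edgeStab e.1) (T.edgeStab e'.1)
  iseqv :=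
    ⟨fun _ => Subgroup.Commensurable.refl _, fun h => h.symm, fun h h' => h.trans h'⟩

/-- A cylinder is an equivalence class of edges. -/
def Cylinder (T : ActionGraph.{u, v} G) : Type v := Quotient T.cylinderSetoid

/-- `G` permutes the cylinders. -/
instance cylinderAction (T : ActionGraph.{u, v} G) : MulAction G T.Cylinder where
  smul g := Quotient.map (g • ·) fun e e' h => by
    change Subgroup.Commensurable (T.edgeStab (e.1.map (g • ·))) (T.edgeStab (e'.1.map (g • ·)))
    rw [edgeStab_map, edgeStab_map]
    exact Subgroup.Commensurable.conj h _
  one_smul Y := by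
    induction Y using Quotient.ind with
    | _ e => exact congrArg (Quotient.mk T.cylinderSetoid) (one_smul G e)
  mul_smul g h Y := by
    induction Y using Quotient.ind with
    | _ e => exact congrArg (Quotient.mk T.cylinderSetoid) (mul_smul g h e)

/-- The vertex `x` belongs to the cylinder `Y` (viewed as the union of its edges). -/
def MemCylinder (T : ActionGraph.{u, v} G) (x : T.V) (Y : T.Cylinder) : Prop :=
  ∃ e : T.graph.edgeSet, Quotient.mk T.cylinderSetoid e = Y ∧ x ∈ e.1

theorem MemCylinder.smul {T : ActionGraph.{u, v} G} (g : G) {x : T.V} {Y : T.Cylinder}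
    (h : T.MemCylinder x Y) : T.MemCylinder (g • x) (g • Y) := by
  obtain ⟨e, rfl, hx⟩ := h
  exact ⟨g • e, rfl, Sym2.mem_map.2 ⟨x, hx, rfl⟩⟩

/-- `V₀(T_c)`: the vertices of `T` belonging to (at least) two distinct cylinders. -/
def BoundaryVertex (T : ActionGraph.{u, v} G) : Type v :=
  {x : T.V // ∃ Y Y' : T.Cylinder, Y ≠ Y' ∧ T.MemCylinder x Y ∧ T.MemCylinder x Y'}

instance boundaryVertexAction (T : ActionGraph.{u, v} G) : MulAction G T.BoundaryVertex where
  smul g x := ⟨g • x.1, by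
    obtain ⟨Y, Y', hne, h, h'⟩ := x.2
    exact ⟨g • Y, g • Y', fun heq => hne (MulAction.injective g heq), h.smul g, h'.smul g⟩⟩
  one_smul x := Subtype.ext (one_smul G x.1)
  mul_smul g h x := Subtype.ext (mul_smul g h x.1)

/-- The tree of cylinders `T_c`: the bipartite graph with vertex set `V₀(T_c) ⊔ V₁(T_c)`, where
`V₁(T_c)` is the set of cylinders, in which `x ∈ V₀(T_c)` is joined to the cylinder `Y` if and
only if `x` belongs to `Y`. -/
def treeOfCylinders (T : ActionGraph.{u, v} G) : ActionGraph.{u, v} G where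
  V := T.BoundaryVertex ⊕ T.Cylinder
  graph :=
    { Adj := fun a b => ∃ (x : T.BoundaryVertex) (Y : T.Cylinder), T.MemCylinder x.1 Y ∧
        ((a = Sum.inl x ∧ b = Sum.inr Y) ∨ (a = Sum.inr Y ∧ b = Sum.inl x))
      symm := ⟨fun _ _ ⟨x, Y, h, h'⟩ => ⟨x, Y, h, h'.symm.imp And.symm And.symm⟩⟩
      loopless := ⟨by
        rintro a ⟨x, Y, -, ⟨h, h'⟩ | ⟨h, h'⟩⟩ <;> exact absurd (h.symm.trans h') (by simp)⟩ }
  smul_adj := by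
    rintro g a b ⟨x, Y, h, ⟨rfl, rfl⟩ | ⟨rfl, rfl⟩⟩
    · exact ⟨g • x, g • Y, h.smul g, Or.inl ⟨rfl, rfl⟩⟩
    · exact ⟨g • x, g • Y, h.smul g, Or.inr ⟨rfl, rfl⟩⟩

/-! ### Collapsing -/

/-- The subgraph (on all vertices) made of the edges whose stabilizer is not infinite cyclic. -/
def collapsedEdges (T : ActionGraph.{u, v} G) : SimpleGraph T.V where
  Adj x y := T.graph.Adj x y ∧ ¬ IsInfiniteCyclic (T.edgeStab s(x, y))
  symm := ⟨fun x y h => ⟨h.1.symm, by rw [Sym2.eq_swap]; exact h.2⟩⟩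
  loopless := ⟨fun _ h => h.1.ne rfl⟩

/-- Each `g` acts on the graph of collapsed edges. -/
def collapsedHom (T : ActionGraph.{u, v} G) (g : G) : T.collapsedEdges →g T.collapsedEdges where
  toFun x := g • x
  map_rel' {x y} h := ⟨T.smul_adj g h.1, by
    have := T.edgeStab_map g s(x, y)
    rw [Sym2.map_mk] at this
    rw [this, isInfiniteCyclic_conj_iff]
    exact h.2⟩

instance collapsedAction (T : ActionGraph.{u, v} G) :
    MulAction G T.collapsedEdges.ConnectedComponent where
  smul g C := C.map (T.collapsedHom g)
  one_smul C := by
    induction C using SimpleGraph.ConnectedComponent.ind with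
    | _ x => exact congrArg T.collapsedEdges.connectedComponentMk (one_smul G x)
  mul_smul g h C := by
    induction C using SimpleGraph.ConnectedComponent.ind with
    | _ x => exact congrArg T.collapsedEdges.connectedComponentMk (mul_smul g h x)

/-- The graph obtained by collapsing to a point each edge whose stabilizer is not infinite cyclic:
its vertices are the connected components of the union of the collapsed edges, its edges come
from the edges which are not collapsed. -/
def collapse (T : ActionGraph.{u, v} G) : ActionGraph.{u, v} G where
  V := T.collapsedEdges.ConnectedComponent
  graph :=
    { Adj := fun C D => C ≠ D ∧ ∃ x y : T.V, T.collapsedEdges.connectedComponentMk x = C ∧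
        T.collapsedEdges.connectedComponentMk y = D ∧ T.graph.Adj x y
      symm := ⟨fun _ _ ⟨hne, x, y, hx, hy, h⟩ => ⟨hne.symm, y, x, hy, hx, h.symm⟩⟩
      loopless := ⟨fun _ h => h.1 rfl⟩ }
  smul_adj := by
    rintro g C D ⟨hne, x, y, rfl, rfl, h⟩
    exact ⟨fun heq => hne (MulAction.injective g heq), g • x, g • y, rfl, rfl, T.smul_adj g h⟩

/-- The collapsed tree of cylinders `T_c^*`, obtained from `T_c` by collapsing all edges whose
stabilizer is not infinite cyclic. -/
def collapsedTreeOfCylinders (T : ActionGraph.{u, v} G) : ActionGraph.{u, v} G :=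
  T.treeOfCylinders.collapse

end ActionGraph

/-- Commutation is a transitive relation on non-trivial elements. -/
def IsCommutativeTransitive (G : Type u) [Group G] : Prop :=
  ∀ a b c : G, a ≠ 1 → b ≠ 1 → c ≠ 1 → Commute a b → Commute b c → Commute a c

/-- The Baumslag–Solitar group `BS(1,s) = ⟨a, t ∣ t a t⁻¹ = a ^ s⟩`; here `a` and `t` are the
generators indexed by `0` and `1`. -/
abbrev BS1 (s : ℤ) : Type :=
  PresentedGroup ({FreeGroup.of 1 * FreeGroup.of 0 * (FreeGroup.of 1)⁻¹ * (FreeGroup.of 0 ^ s)⁻¹} :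
    Set (FreeGroup (Fin 2)))

/-- A group isomorphic to the solvable Baumslag–Solitar group `BS(1,s)` for some `s ≠ 0`. -/
def IsSolvableBS (H : Type u) [Group H] : Prop :=
  ∃ s : ℤ, s ≠ 0 ∧ Nonempty (H ≃* BS1 s)

/-! Fix a cylinder `Y` and a generator `a` of the stabilizer of one of its edges. The vertices of
`Y` are those fixed by a non-trivial power of `a` (`memCylinder_iff`), and they form a convex set.
The stabilizer `H` of `Y` is the group of elements conjugating some nonzero power of `a` to another
one (`isVirtualNormalizer_stabilizer`). Two cylinders share at most one vertex, because the
pointwise stabilizer of two vertices is cyclic; this is what makes `T_c` a tree.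

The core is the dichotomy `exists_fixed_or_isSolvableBS`: `H` fixes a vertex of `Y`, or `H` is some
BS(1,s). By commutative transitivity the centralizer `C` of `a` is abelian, and it is normal in `H`.
If `G_x ∩ H` is non-cyclic for some vertex `x` of `Y`, then `H` fixes `x`. Otherwise there are three
cases. If an element of `C` fixes no vertex of `Y`, it has an axis, `H = C`, and `H` shifts a ray of
this axis. If every element of `C` fixes a vertex of `Y` but no vertex of `Y` is fixed by all of
`C`, then `H` fixes an end, and finite generation of `G` provides a non-zero shift. In both cases
`isSolvableBS_of_hasShift` identifies `H`. Finally, if `C` fixes a vertex of `Y`, it is cyclic, `H`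
centralizes it, and `H = C`.

A cylinder has at most one vertex `x` with `G_x ∩ H` non-cyclic. So the collapsed components of
`T_c` are stars around boundary vertices or isolated cylinders, and the centre of each has the same
stabilizer as the component; this compares `T_c` with `T_c^*`. Conversely, a BS(1,s) subgroup fixes
a vertex of `T`, or virtually normalizes a non-trivial cyclic group fixing two vertices and hence
preserves a cylinder. An element fixing an edge of `T_c^*` determines the cylinder at its end,
whence 2-acylindricity. In an acylindrical tree dominated by `T`, the vertices fixed by powers of
`a` form a bounded `H`-invariant convex set, so `H` is elliptic there. -/

namespace SimpleGraph

/-! ### Geodesics and medians in a tree. -/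

variable {V : Type*} {Γ : SimpleGraph V}

/-- The vertex `z` lies on a geodesic from `x` to `y`. -/
def Btw (Γ : SimpleGraph V) (x z y : V) : Prop :=
  Γ.dist x z + Γ.dist z y = Γ.dist x y

theorem Btw.symm {x z y : V} (h : Γ.Btw x z y) : Γ.Btw y z x := by
  unfold Btw at *
  rw [Γ.dist_comm (u := y) (v := z), Γ.dist_comm (u := z) (v := x), Γ.dist_comm (u := y) (v := x)]
  omega

theorem btw_left (x y : V) : Γ.Btw x x y := by simp [Btw]

theorem btw_right (x y : V) : Γ.Btw x y y := by simp [Btw]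

namespace IsTree

theorem tri (hΓ : Γ.IsTree) (x y z : V) : Γ.dist x z ≤ Γ.dist x y + Γ.dist y z :=
  hΓ.1.dist_triangle

theorem eq_of_dist (hΓ : Γ.IsTree) {x y : V} (h : Γ.dist x y = 0) : x = y :=
  hΓ.1.dist_eq_zero_iff.1 h

theorem dist_pos (hΓ : Γ.IsTree) {x y : V} (h : x ≠ y) : 0 < Γ.dist x y :=
  hΓ.1.pos_dist_of_ne h

theorem length_eq_dist (hΓ : Γ.IsTree) {x y : V} (p : Γ.Walk x y) (hp : p.IsPath) :
    p.length = Γ.dist x y := by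
  obtain ⟨q, hq, hq'⟩ := hΓ.1.exists_path_of_dist x y
  rw [← hq', (hΓ.existsUnique_path x y).unique hp hq]

theorem exists_adj_closer (hΓ : Γ.IsTree) {x m : V} (h : x ≠ m) :
    ∃ n, Γ.Adj m n ∧ Γ.dist x m = Γ.dist x n + 1 := by
  obtain ⟨p, hp, hp'⟩ := hΓ.1.exists_path_of_dist m x
  cases p with
  | nil => exact absurd rfl h
  | cons hadj q =>
    rename_i n
    refine ⟨n, hadj, ?_⟩
    have h1 := hΓ.length_eq_dist q hp.of_cons
    rw [Walk.length_cons] at hp'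
    rw [dist_comm, dist_comm (u := x)]
    omega

/-- The geodesics from `m` to `x` and to `y` either share their first edge, or concatenate without
backtracking, and a path in a tree is a geodesic. -/
theorem btw_or_exists_adj_closer (hΓ : Γ.IsTree) (x m y : V) : Γ.Btw x m y ∨
    ∃ n, Γ.Adj m n ∧ Γ.dist x m = Γ.dist x n + 1 ∧ Γ.dist y m = Γ.dist y n + 1 := by
  obtain ⟨p, hp, hp'⟩ := hΓ.1.exists_path_of_dist m x
  obtain ⟨q, hq, hq'⟩ := hΓ.1.exists_path_of_dist m y
  cases p with
  | nil => exact Or.inl (btw_left _ _)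
  | cons hadj p =>
  cases q with
  | nil => exact Or.inl (btw_right _ _)
  | cons hadj' q =>
  rename_i n n'
  by_cases hn : n = n'
  · subst hn
    refine Or.inr ⟨n, hadj, ?_⟩
    have h1 := hΓ.length_eq_dist p hp.of_cons
    have h2 := hΓ.length_eq_dist q hq.of_cons
    rw [Walk.length_cons] at hp' hq'
    rw [dist_comm, dist_comm (u := x), dist_comm (u := y), dist_comm (u := y) (v := n)]
    omega
  · left
    have : ((Walk.cons hadj p).reverse.append (Walk.cons hadj' q)).IsPath := by
      have h1 := hp.reverse
      rw [hΓ.2.isPath_iff_isChain] at h1 hq ⊢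
      rw [Walk.edges_append]
      refine List.isChain_append.2 ⟨h1, hq, ?_⟩
      intro e he e' he'
      simp at he he'
      subst he he'
      simp only [ne_eq, Sym2.eq_iff, not_or, not_and]
      exact ⟨fun _ h => hn (by aesop), fun h => by aesop⟩
    have h3 := hΓ.length_eq_dist _ this
    rw [Walk.length_append, Walk.length_reverse, hp', hq', dist_comm] at h3
    exact h3

/-- A neighbour of `m` closer to `x` is unique. -/
theorem adj_closer_unique (hΓ : Γ.IsTree) {x m n n' : V} (h : Γ.Adj m n) (h' : Γ.Adj m n')
    (hn : Γ.dist x m = Γ.dist x n + 1) (hn' : Γ.dist x m = Γ.dist x n' + 1) : n = n' := by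
  obtain ⟨p, hp, hp'⟩ := hΓ.1.exists_path_of_dist n x
  obtain ⟨q, hq, hq'⟩ := hΓ.1.exists_path_of_dist n' x
  rw [dist_comm] at hp' hq'
  have e := (hΓ.existsUnique_path m x).unique (y₁ := Walk.cons h p) (y₂ := Walk.cons h' q)
    (Walk.isPath_of_length_eq_dist _ (by rw [Walk.length_cons, hp', dist_comm (u := m), hn]))
    (Walk.isPath_of_length_eq_dist _ (by rw [Walk.length_cons, hq', dist_comm (u := m), hn']))
  simpa using congrArg Walk.snd e

theorem exists_btw (hΓ : Γ.IsTree) (x : V) {y : V} {k : ℕ} (hk : k ≤ Γ.dist x y) :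
    ∃ z, Γ.Btw x z y ∧ Γ.dist x z = k := by
  obtain ⟨d, hd⟩ := Nat.exists_eq_add_of_le hk
  induction d generalizing y with
  | zero => exact ⟨y, btw_right x y, hd⟩
  | succ d ih =>
    have hne : x ≠ y := by rintro rfl; simp at hd
    obtain ⟨n, hn, hn'⟩ := hΓ.exists_adj_closer hne
    obtain ⟨z, hz, hz'⟩ := ih (y := n) (by omega) (by omega)
    refine ⟨z, ?_, hz'⟩
    have h1 := hΓ.tri z n y
    have h2 := hΓ.tri x z y
    have h3 : Γ.dist n y = 1 := dist_eq_one_iff_adj.2 hn.symm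
    unfold Btw at *
    omega

theorem eq_of_btw (hΓ : Γ.IsTree) {x y z z' : V} (h : Γ.Btw x z y) (h' : Γ.Btw x z' y)
    (he : Γ.dist x z = Γ.dist x z') : z = z' := by
  generalize hd : Γ.dist z y = d
  induction d generalizing y z z' with
  | zero =>
    have h1 : Γ.dist z' y = 0 := by unfold Btw at *; omega
    rw [hΓ.eq_of_dist hd, hΓ.eq_of_dist h1]
  | succ d ih =>
    have h1 : Γ.dist z' y = d + 1 := by unfold Btw at *; omega
    have hz : z ≠ y := by rintro rfl; simp at hd
    have hz' : z' ≠ y := by rintro rfl; simp at h1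
    obtain ⟨n, hn, hn'⟩ := hΓ.exists_adj_closer hz
    obtain ⟨m, hm, hm'⟩ := hΓ.exists_adj_closer hz'
    have t1 : Γ.dist n y = 1 := dist_eq_one_iff_adj.2 hn.symm
    have t2 : Γ.dist m y = 1 := dist_eq_one_iff_adj.2 hm.symm
    have t3 := hΓ.tri x n y
    have t4 := hΓ.tri x m y
    have t5 := hΓ.tri x z n
    have t6 := hΓ.tri x z' m
    unfold Btw at h h'
    have e1 : Γ.dist x y = Γ.dist x n + 1 := by omega
    have e2 : Γ.dist x y = Γ.dist x m + 1 := by omega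
    obtain rfl := hΓ.adj_closer_unique hn hm e1 e2
    have b1 : Γ.Btw x z n := by unfold Btw; omega
    have b2 : Γ.Btw x z' n := by unfold Btw; omega
    exact ih b1 b2 he (by omega)

theorem btw_trans (hΓ : Γ.IsTree) {x y z w : V} (h : Γ.Btw x y z) (h' : Γ.Btw x z w) :
    Γ.Btw x y w ∧ Γ.Btw y z w := by
  have h1 := hΓ.tri y z w
  have h2 := hΓ.tri x y w
  unfold Btw at *
  omega

/-- Two points on a geodesic are ordered. -/
theorem btw_of_le (hΓ : Γ.IsTree) {x y z w : V} (h : Γ.Btw x z w) (h' : Γ.Btw x y w)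
    (hle : Γ.dist x y ≤ Γ.dist x z) : Γ.Btw x y z ∧ Γ.Btw y z w := by
  obtain ⟨y', hy, hy'⟩ := hΓ.exists_btw x hle
  have h1 := hΓ.btw_trans hy h
  obtain rfl := hΓ.eq_of_btw h1.1 h' hy'
  exact ⟨hy, h1.2⟩

/-- As long as `x` is not itself the median, it can be moved one step towards `y` and `z`
simultaneously. -/
theorem exists_median (hΓ : Γ.IsTree) (x y z : V) :
    ∃ m, Γ.Btw x m y ∧ Γ.Btw y m z ∧ Γ.Btw x m z := by
  generalize hd : Γ.dist x y + Γ.dist x z = d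
  induction d using Nat.strong_induction_on generalizing x with
  | _ d ih =>
    rcases hΓ.btw_or_exists_adj_closer y x z with h | ⟨n, hn, h1, h2⟩
    · exact ⟨x, btw_left x y, h, btw_left x z⟩
    · rw [dist_comm (v := x), dist_comm (v := n)] at h1 h2
      obtain ⟨m, hm, hm', hm''⟩ := ih _ (by omega) n rfl
      have t3 : Γ.dist x n = 1 := dist_eq_one_iff_adj.2 hn
      have t1 := hΓ.tri x n m
      have t2 := hΓ.tri x m y
      have t4 := hΓ.tri x m z
      refine ⟨m, ?_, hm', ?_⟩ <;> unfold Btw at * <;> omega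

/-- Overlapping geodesics concatenate to a geodesic. -/
theorem btw_concat (hΓ : Γ.IsTree) {x y z w : V} (h : Γ.Btw x y z) (h' : Γ.Btw y z w)
    (hne : y ≠ z) : Γ.Btw x z w := by
  obtain ⟨m, h1, h2, h3⟩ := hΓ.exists_median x z w
  by_cases hle : Γ.dist x y ≤ Γ.dist x m
  · have h4 := (hΓ.btw_of_le h1 h hle).2
    have t1 := hΓ.tri y m w
    have t2 : Γ.dist z m = Γ.dist m z := dist_comm
    have : m = z := hΓ.eq_of_dist (by unfold Btw at *; omega)
    rwa [← this]
  · have h4 := (hΓ.btw_of_le h h1 (by omega)).2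
    have h5 := hΓ.btw_trans h4.symm h2
    have t1 := h5.1
    have t2 : Γ.dist z y = Γ.dist y z := dist_comm
    have : y = z := hΓ.eq_of_dist (by unfold Btw at *; omega)
    exact absurd this hne

theorem btw_or_btw (hΓ : Γ.IsTree) {x y : V} (z : V) {p : V} (h : Γ.Btw x p y) :
    Γ.Btw x p z ∨ Γ.Btw z p y := by
  obtain ⟨m, h1, h2, h3⟩ := hΓ.exists_median x y z
  by_cases hle : Γ.dist x p ≤ Γ.dist x m
  · exact Or.inl (hΓ.btw_trans (hΓ.btw_of_le h1 h hle).1 h3).1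
  · have h4 := (hΓ.btw_of_le h h1 (by omega)).2
    exact Or.inr (hΓ.btw_trans h4.symm h2).1.symm

theorem finite_btw (hΓ : Γ.IsTree) (x y : V) : {z | Γ.Btw x z y}.Finite := by
  refine Set.Finite.of_injOn (f := Γ.dist x) (t := Set.Iic (Γ.dist x y)) ?_ ?_ (Set.finite_Iic _)
  · intro z hz
    have : Γ.Btw x z y := hz
    unfold Btw at this
    simp only [Set.mem_Iic]
    omega
  · intro z hz z' hz' h
    exact hΓ.eq_of_btw hz hz' h

end IsTree

/-- A geodesically convex set of vertices. -/
def GConvex (Γ : SimpleGraph V) (S : Set V) : Prop :=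
  ∀ ⦃x⦄, x ∈ S → ∀ ⦃y⦄, y ∈ S → ∀ ⦃z⦄, Γ.Btw x z y → z ∈ S

theorem GConvex.inter {S S' : Set V} (h : Γ.GConvex S) (h' : Γ.GConvex S') :
    Γ.GConvex (S ∩ S') :=
  fun _ hx _ hy _ hz => ⟨h hx.1 hy.1 hz, h' hx.2 hy.2 hz⟩

/-! ### Projections to convex sets, rays and ends. -/

namespace IsTree

/-- The projection of a vertex to a convex set. -/
theorem exists_gate (hΓ : Γ.IsTree) {S : Set V} (hS : Γ.GConvex S) (hne : S.Nonempty) (x : V) :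
    ∃ p ∈ S, ∀ v ∈ S, Γ.Btw x p v := by
  obtain ⟨p, hp, hmin⟩ := WellFounded.has_min (measure (Γ.dist x)).wf S hne
  refine ⟨p, hp, fun v hv => ?_⟩
  rcases hΓ.btw_or_exists_adj_closer x p v with h | ⟨n, hn, h1, h2⟩
  · exact h
  · have hb : Γ.Btw p n v := by
      rw [dist_comm (v := p), dist_comm (v := n)] at h2
      have : Γ.dist p n = 1 := dist_eq_one_iff_adj.2 hn
      unfold Btw
      omega
    refine absurd ?_ (hmin n (hS hp hv hb))
    change Γ.dist x n < Γ.dist x p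
    omega

/-- A family of points and sets `p i ∈ K i`, each `p i` separating `x` from `K i`, directed and
with unbounded distances to `x`, converges to an end of the tree, represented by a ray. -/
theorem exists_ray (hΓ : Γ.IsTree) {ι : Type*} (x : V) (p : ι → V) (K : ι → Set V)
    (hK : ∀ i, ∀ v ∈ K i, Γ.Btw x (p i) v)
    (hdir : ∀ i j, (K i ∩ K j).Nonempty) (hunb : ∀ n, ∃ i, n ≤ Γ.dist x (p i)) :
    ∃ r : ℕ → V, r 0 = x ∧ (∀ m n, m ≤ n → Γ.dist (r m) (r n) = n - m) ∧
      (∀ n, ∃ i, Γ.Btw x (r n) (p i)) ∧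
      (∀ i n, Γ.dist x (p i) ≤ n → ∃ v ∈ K i, Γ.Btw (p i) (r n) v) := by
  have h1 : ∀ n, ∃ z i, Γ.Btw x z (p i) ∧ Γ.dist x z = n := fun n => by
    obtain ⟨i, hi⟩ := hunb n
    obtain ⟨z, hz, hz'⟩ := hΓ.exists_btw x hi
    exact ⟨z, i, hz, hz'⟩
  choose r c hr hr' using h1
  refine ⟨r, (hΓ.eq_of_dist (hr' 0)).symm, fun m n hmn => ?_, fun n => ⟨c n, hr n⟩, fun i n hin => ?_⟩
  -- A common point `v` of the two sets lies behind both gates, so `r m` and `r n` are on the single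
  -- geodesic from `x` to `v`.
  · obtain ⟨v, hv, hv'⟩ := hdir (c m) (c n)
    have h2 := (hΓ.btw_trans (hr m) (hK _ v hv)).1
    have h3 := (hΓ.btw_trans (hr n) (hK _ v hv')).1
    have h4 := (hΓ.btw_of_le h3 h2 (by rw [hr', hr']; exact hmn)).1
    unfold Btw at h4
    rw [hr', hr'] at h4
    omega
  · obtain ⟨v, hv, hv'⟩ := hdir i (c n)
    have h3 := (hΓ.btw_trans (hr n) (hK _ v hv')).1
    exact ⟨v, hv, (hΓ.btw_of_le h3 (hK _ v hv) (by rw [hr']; exact hin)).2⟩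

/-- Two rays are either asymptotic, or separated by a vertex of the first one. -/
theorem ray_dichotomy (hΓ : Γ.IsTree) {r r' : ℕ → V}
    (hr : ∀ m n, m ≤ n → Γ.dist (r m) (r n) = n - m)
    (hr' : ∀ m n, m ≤ n → Γ.dist (r' m) (r' n) = n - m) :
    (∃ i j, ∀ n, r' (n + i) = r (n + j)) ∨
      ∃ N K, ∀ n k, N ≤ n → K ≤ k → Γ.Btw (r n) (r N) (r' k) := by
  -- the distance to a base point is eventually increasing along a ray
  have hinc : ∃ K, ∀ k l, K ≤ k → k ≤ l → Γ.Btw (r 0) (r' k) (r' l) := by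
    -- The function `dist (r 0) (r' k) - k` is bounded below by `-dist (r 0) (r' 0)`; adding this
    -- constant makes it a natural number without truncation. It cannot increase with `k`, so it is
    -- constant from its minimum on.
    obtain ⟨K, -, hmin⟩ := WellFounded.has_min
      (measure fun k => Γ.dist (r 0) (r' k) + Γ.dist (r 0) (r' 0) - k).wf Set.univ ⟨0, trivial⟩
    have key : ∀ k, K ≤ k → Γ.dist (r 0) (r' k) + K = Γ.dist (r 0) (r' K) + k := fun k hk => by
      have h1 : ¬ (Γ.dist (r 0) (r' k) + Γ.dist (r 0) (r' 0) - k <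
        Γ.dist (r 0) (r' K) + Γ.dist (r 0) (r' 0) - K) := hmin k trivial
      have h2 := hΓ.tri (r 0) (r' K) (r' k)
      have h3 := hΓ.tri (r' 0) (r 0) (r' k)
      have h4 := hΓ.tri (r' 0) (r 0) (r' K)
      rw [hr' _ _ hk] at h2
      rw [hr' _ _ (Nat.zero_le _), dist_comm] at h3 h4
      omega
    refine ⟨K, fun k l hk hl => ?_⟩
    have h1 := key k hk
    have h2 := key l (hk.trans hl)
    unfold Btw
    rw [hr' _ _ hl]
    omega
  obtain ⟨K, hK⟩ := hinc
  by_cases h : ∀ n, ∃ k, K ≤ k ∧ Γ.Btw (r 0) (r n) (r' k)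
  · left
    refine ⟨K, Γ.dist (r 0) (r' K), fun n => ?_⟩
    obtain ⟨k, hk, hk'⟩ := h (n + Γ.dist (r 0) (r' K))
    have h1 : Γ.Btw (r 0) (r (n + Γ.dist (r 0) (r' K))) (r' (max k (n + K))) :=
      (hΓ.btw_trans hk' (hK k _ hk (le_max_left _ _))).1
    have h2 := hK (n + K) (max k (n + K)) (by omega) (le_max_right _ _)
    have h3 := hK K (n + K) le_rfl (by omega)
    refine hΓ.eq_of_btw h2 h1 ?_
    rw [hr 0 _ (Nat.zero_le _)]
    unfold Btw at h3
    rw [hr' K (n + K) (by omega)] at h3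
    omega
  · right
    push Not at h
    obtain ⟨n₀, hn₀⟩ := h
    have hex : ∃ n, ∀ k, K ≤ k → ¬ Γ.Btw (r 0) (r (n + 1)) (r' k) := by
      cases n₀ with
      | zero => exact absurd (btw_left _ _) (hn₀ K le_rfl)
      | succ n => exact ⟨n, hn₀⟩
    classical
    -- `r N` is the last vertex that `r` shares with a geodesic from `r 0` to a vertex of the tail
    -- of `r'`: the branching point.
    obtain ⟨N, hN, hmin⟩ : ∃ N, (∀ k, K ≤ k → ¬ Γ.Btw (r 0) (r (N + 1)) (r' k)) ∧
        ∃ k, K ≤ k ∧ Γ.Btw (r 0) (r N) (r' k) := by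
      refine ⟨Nat.find hex, Nat.find_spec hex, ?_⟩
      rcases Nat.eq_zero_or_pos (Nat.find hex) with h0 | h0
      · rw [h0]
        exact ⟨K, le_rfl, btw_left _ _⟩
      · obtain ⟨j, hj⟩ := Nat.exists_eq_succ_of_ne_zero h0.ne'
        have := Nat.find_min hex (m := j) (by omega)
        push Not at this
        rw [hj]
        exact this
    obtain ⟨k₀, hk₀, hb⟩ := hmin
    refine ⟨N, k₀, fun n k hn hk => ?_⟩
    have hb' : Γ.Btw (r 0) (r N) (r' k) := (hΓ.btw_trans hb (hK k₀ k hk₀ hk)).1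
    rcases Nat.eq_or_lt_of_le hn with rfl | hlt
    · exact btw_left _ _
    have hline : ∀ a b c, a ≤ b → b ≤ c → Γ.Btw (r a) (r b) (r c) := fun a b c h h' => by
      unfold Btw
      rw [hr _ _ h, hr _ _ h', hr _ _ (h.trans h')]
      omega
    -- Otherwise the geodesics from `r N` to `r (N + 1)` and to `r' k` would start with the same
    -- edge, putting `r (N + 1)` on the geodesic from `r 0` to `r' k`.
    have hN1 : Γ.Btw (r (N + 1)) (r N) (r' k) := by
      rcases hΓ.btw_or_exists_adj_closer (r (N + 1)) (r N) (r' k) with h | ⟨z, hz, h1, h2⟩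
      · exact h
      · exfalso
        rw [dist_comm, hr _ _ (Nat.le_succ N)] at h1
        have hz' : r (N + 1) = z := hΓ.eq_of_dist (by omega)
        subst hz'
        refine hN k (hk₀.trans hk) ?_
        have h3 := hline 0 N (N + 1) (by omega) (by omega)
        have h4 := hr N (N + 1) (by omega)
        rw [dist_comm, dist_comm (v := r (N + 1))] at h2
        unfold Btw at *
        omega
    refine hΓ.btw_concat (hline N (N + 1) n (by omega) (by omega)).symm hN1 fun he => ?_
    have h4 := hr N (N + 1) (by omega)
    rw [he, dist_self] at h4
    omega

end IsTree

end SimpleGraph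

/-! ### Fixed points and axes of tree automorphisms. -/

namespace ActionGraph

open SimpleGraph

variable {G : Type u} [Group G] {T : ActionGraph.{u, v} G}

theorem dist_smul (hT : T.graph.IsTree) (g : G) (x y : T.V) :
    T.graph.dist (g • x) (g • y) = T.graph.dist x y := by
  have key : ∀ (g : G) (x y : T.V), T.graph.dist (g • x) (g • y) ≤ T.graph.dist x y := by
    intro g x y
    obtain ⟨p, hp⟩ := hT.1.exists_walk_length_eq_dist x y
    let f : T.graph →g T.graph := ⟨fun z => g • z, fun h => T.smul_adj g h⟩
    have := SimpleGraph.dist_le (p.map f)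
    rwa [Walk.length_map, hp] at this
  refine le_antisymm (key g x y) ?_
  simpa using key g⁻¹ (g • x) (g • y)

theorem btw_smul (hT : T.graph.IsTree) (g : G) {x y z : T.V} (h : T.graph.Btw x y z) :
    T.graph.Btw (g • x) (g • y) (g • z) := by
  unfold SimpleGraph.Btw
  rw [dist_smul hT, dist_smul hT, dist_smul hT]
  exact h

theorem smul_eq_of_btw (hT : T.graph.IsTree) {g : G} {x y z : T.V} (hx : g • x = x)
    (hz : g • z = z) (h : T.graph.Btw x y z) : g • y = y := by
  have h1 := btw_smul hT g h
  have h2 := dist_smul hT g x y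
  rw [hx, hz] at h1
  rw [hx] at h2
  exact hT.eq_of_btw h1 h h2

theorem gconvex_fixed (hT : T.graph.IsTree) (g : G) : T.graph.GConvex {x : T.V | g • x = x} :=
  fun _ hx _ hy _ hz => smul_eq_of_btw hT hx hy hz

theorem zpow_smul_eq {g : G} {x : T.V} (hx : g • x = x) (n : ℤ) : g ^ n • x = x :=
  (MulAction.stabilizer G x).zpow_mem (x := g) hx n

/-- The vertices fixed by some non-trivial power of `a`. -/
def virtualFix (T : ActionGraph.{u, v} G) (a : G) : Set T.V :=
  {x | ∃ n : ℤ, n ≠ 0 ∧ a ^ n • x = x}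

theorem exists_common_zpow_fixing {a : G} {x y : T.V} (hx : x ∈ T.virtualFix a)
    (hy : y ∈ T.virtualFix a) : ∃ n : ℤ, n ≠ 0 ∧ a ^ n • x = x ∧ a ^ n • y = y := by
  obtain ⟨n, hn, hx⟩ := hx
  obtain ⟨m, hm, hy⟩ := hy
  refine ⟨n * m, mul_ne_zero hn hm, ?_, ?_⟩
  · rw [zpow_mul]; exact zpow_smul_eq hx m
  · rw [mul_comm, zpow_mul]; exact zpow_smul_eq hy n

theorem gconvex_virtualFix (hT : T.graph.IsTree) (a : G) :
    T.graph.GConvex (T.virtualFix a) := by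
  intro x hx y hy z hz
  obtain ⟨n, hn, hnx, hny⟩ := exists_common_zpow_fixing hx hy
  exact ⟨n, hn, smul_eq_of_btw hT hnx hny hz⟩

/-- In each invariant convex set, an element fixes a vertex or has an axis. -/
theorem exists_axis (hT : T.IsGTree) {S : Set T.V} (hS : T.graph.GConvex S) (hne : S.Nonempty)
    {h : G} (hinv : ∀ x ∈ S, h • x ∈ S) : ∃ y ∈ S, T.graph.Btw y (h • y) (h • h • y) := by
  obtain ⟨y, hy, hmin⟩ :=
    WellFounded.has_min (measure fun x => T.graph.dist x (h • x)).wf S hne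
  refine ⟨y, hy, ?_⟩
  rcases hT.1.btw_or_exists_adj_closer y (h • y) (h • h • y) with hb | ⟨n, hn, h1, h2⟩
  · exact hb
  exfalso
  -- Backtracking at `h • y` puts both `n'` and `h • n'` on the geodesic from `y` to `h • y`. Either
  -- the edge from `y` to `n'` is inverted, or `n'` is displaced less than `y`.
  obtain ⟨n', rfl⟩ : ∃ n', n = h • n' := ⟨h⁻¹ • n, by simp⟩
  rw [dist_smul hT.1, dist_smul hT.1] at h2
  have hadj : T.graph.Adj y n' := by simpa using T.smul_adj h⁻¹ hn
  have e1 : T.graph.dist y n' = 1 := dist_eq_one_iff_adj.2 hadj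
  have e3 : T.graph.dist (h • n') (h • y) = 1 := dist_eq_one_iff_adj.2 hn.symm
  have e4 := dist_smul hT.1 h y n'
  rw [dist_comm (v := n')] at h2
  rw [dist_comm] at h2
  have hb1 : T.graph.Btw y n' (h • y) := by
    unfold SimpleGraph.Btw
    omega
  have hb2 : T.graph.Btw y (h • n') (h • y) := by
    unfold SimpleGraph.Btw
    omega
  by_cases hd : T.graph.dist y (h • y) = 1
  · have z1 : h • n' = y := (hT.1.eq_of_dist (by omega)).symm
    have z2 : n' = h • y := by
      refine hT.1.eq_of_dist ?_
      unfold SimpleGraph.Btw at hb1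
      omega
    refine hT.2 h y n' hadj ⟨z2.symm, z1⟩
  · have hle : T.graph.dist y n' ≤ T.graph.dist y (h • n') := by omega
    have hb3 := (hT.1.btw_of_le hb2 hb1 hle).1
    have := hmin n' (hS hy (hinv y hy) hb1)
    apply this
    change T.graph.dist n' (h • n') < T.graph.dist y (h • y)
    unfold SimpleGraph.Btw at hb3
    omega

/-- Translates of the geodesic through `y`, `h • y`, `h • h • y` overlap in non-degenerate segments,
so they fit together into one geodesic by `btw_concat`. -/
theorem dist_pow_smul (hT : T.graph.IsTree) {h : G} {y : T.V} (hne : h • y ≠ y)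
    (hb : T.graph.Btw y (h • y) (h • h • y)) (n : ℕ) :
    T.graph.dist y (h ^ n • y) = n * T.graph.dist y (h • y) ∧
      T.graph.Btw y (h ^ n • y) (h ^ (n + 1) • y) := by
  induction n with
  | zero => simpa using btw_left _ _
  | succ n ih =>
    have h1 := btw_smul hT (h ^ n) hb
    rw [← mul_smul, ← mul_smul, ← mul_smul, ← pow_succ, ← pow_succ] at h1
    have h2 := dist_smul hT (h ^ n) y (h • y)
    rw [← mul_smul, ← pow_succ] at h2
    have h3 := ih.2
    refine ⟨?_, hT.btw_concat h3 h1 fun he => hne ?_⟩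
    · unfold SimpleGraph.Btw at h3
      rw [← h3, ih.1, h2]
      ring
    · rw [pow_succ, mul_smul] at he
      exact ((MulAction.injective (h ^ n)) he).symm

theorem btw_pow_smul (hT : T.graph.IsTree) {h : G} {y : T.V} (hne : h • y ≠ y)
    (hb : T.graph.Btw y (h • y) (h • h • y)) {m n : ℕ} (hmn : m ≤ n) :
    T.graph.Btw y (h ^ m • y) (h ^ n • y) := by
  induction n, hmn using Nat.le_induction with
  | base => exact btw_right _ _
  | succ n hmn ih => exact (hT.btw_trans ih (dist_pow_smul hT hne hb n).2).1

/-- Powers of an element with an axis fix no vertex. -/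
theorem zpow_smul_ne_of_axis (hT : T.graph.IsTree) {h : G} {y : T.V} (hne : h • y ≠ y)
    (hb : T.graph.Btw y (h • y) (h • h • y)) {n : ℤ} (hn : n ≠ 0) (z : T.V) :
    h ^ n • z ≠ z := by
  intro hz
  have hm : h ^ n.natAbs • z = z := by
    rcases Int.natAbs_eq n with h1 | h1
    · rw [h1, zpow_natCast] at hz
      exact hz
    · rw [h1, zpow_neg, zpow_natCast, inv_smul_eq_iff] at hz
      exact hz.symm
  have hpos : 0 < n.natAbs := Int.natAbs_pos.2 hn
  -- An element fixing `z` moves `y` by at most twice the distance from `y` to `z`; the exponent is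
  -- chosen to exceed this bound.
  set k := 2 * T.graph.dist y z + 1 with hk
  have h1 := (dist_pow_smul hT hne hb (n.natAbs * k)).1
  have h2 : h ^ (n.natAbs * k) • z = z := by
    have := zpow_smul_eq hm k
    rwa [zpow_natCast, ← pow_mul] at this
  have h3 := dist_smul hT (h ^ (n.natAbs * k)) y z
  rw [h2] at h3
  have h4 := hT.tri y z (h ^ (n.natAbs * k) • y)
  rw [dist_comm (u := z), h3, h1] at h4
  have h5 : 0 < T.graph.dist y (h • y) := hT.dist_pos (Ne.symm hne)
  have h6 : k ≤ n.natAbs * k * T.graph.dist y (h • y) := by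
    rw [mul_comm n.natAbs, mul_assoc]
    exact Nat.le_mul_of_pos_right _ (Nat.mul_pos hpos h5)
  omega

/-- If a non-trivial power of `h` fixes a vertex, then `h` fixes a vertex in each non-empty
`h`-invariant convex set. -/
theorem exists_fixed_of_zpow (hT : T.IsGTree) {S : Set T.V} (hS : T.graph.GConvex S)
    (hne : S.Nonempty) {h : G} (hinv : ∀ x ∈ S, h • x ∈ S) {n : ℤ} (hn : n ≠ 0) {z : T.V}
    (hz : h ^ n • z = z) : ∃ x ∈ S, h • x = x := by
  by_contra! hcon
  obtain ⟨y, hy, hb⟩ := exists_axis hT hS hne hinv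
  exact zpow_smul_ne_of_axis hT.1 (hcon y hy) hb hn z hz

/-- A group preserving a bounded convex set of vertices fixes one of them. -/
theorem exists_fixed_of_bounded (hT : T.IsGTree) {S : Set T.V} (hS : T.graph.GConvex S)
    (hne : S.Nonempty) {H : Subgroup G} (hinv : ∀ g ∈ H, ∀ x ∈ S, g • x ∈ S) {k : ℕ}
    (hk : ∀ x ∈ S, ∀ y ∈ S, T.graph.dist x y ≤ k) : ∃ x ∈ S, ∀ g ∈ H, g • x = x := by
  obtain ⟨s, hs⟩ := hne
  -- Minimizing `k - dist` selects a pair realizing the diameter of `S`.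
  obtain ⟨⟨x, y⟩, ⟨hx, hy⟩, hmin⟩ :=
    WellFounded.has_min (measure fun p : T.V × T.V => k - T.graph.dist p.1 p.2).wf
      (S ×ˢ S) ⟨(s, s), hs, hs⟩
  have hmax : ∀ p ∈ S, ∀ q ∈ S, T.graph.dist p q ≤ T.graph.dist x y := fun p hp q hq => by
    have h1 : ¬ (k - T.graph.dist p q < k - T.graph.dist x y) := hmin (p, q) ⟨hp, hq⟩
    have h2 := hk p hp q hq
    have h3 := hk x hx y hy
    omega
  generalize hD : T.graph.dist x y = D at hmax
  obtain ⟨m, hm, hxm⟩ := hT.1.exists_btw x (y := y) (k := D / 2) (by omega)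
  have hmM : ∀ v ∈ S, T.graph.dist m v ≤ (D + 1) / 2 := fun v hv => by
    have h1 := hmax x hx v hv
    have h2 := hmax v hv y hy
    have h3 : T.graph.dist v m = T.graph.dist m v := dist_comm
    rcases hT.1.btw_or_btw v hm with h | h <;> unfold SimpleGraph.Btw at h hm <;> omega
  -- Each translate of the midpoint is again within `(D + 1) / 2` of all of `S`, so it is one of the
  -- at most two middle vertices of the geodesic from `x` to `y`.
  have hM : ∀ g ∈ H, T.graph.Btw x (g • m) y ∧ T.graph.dist x (g • m) ≤ (D + 1) / 2 ∧
      D / 2 ≤ T.graph.dist x (g • m) := by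
    intro g hg
    have hgm : ∀ v ∈ S, T.graph.dist (g • m) v ≤ (D + 1) / 2 := fun v hv => by
      have := hmM (g⁻¹ • v) (hinv _ (H.inv_mem hg) v hv)
      rwa [← dist_smul hT.1 g, smul_inv_smul] at this
    have h1 := hgm x hx
    have h2 := hgm y hy
    have h4 : T.graph.dist x (g • m) = T.graph.dist (g • m) x := dist_comm
    have h5 : T.graph.dist y (g • m) = T.graph.dist (g • m) y := dist_comm
    have hb : T.graph.Btw x (g • m) y := by
      rcases hT.1.btw_or_exists_adj_closer x (g • m) y with h | ⟨n, hn, h6, h7⟩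
      · exact h
      · have h8 := hT.1.tri x n y
        have h9 : T.graph.dist y n = T.graph.dist n y := dist_comm
        omega
    refine ⟨hb, by omega, ?_⟩
    unfold SimpleGraph.Btw at hb
    omega
  refine ⟨m, hS hx hy hm, fun g hg => ?_⟩
  -- If `g` moves `m`, it exchanges the two middle vertices, which is an inversion.
  by_contra hne
  have hodd : ∀ g' ∈ H, T.graph.dist x (g' • m) = T.graph.dist x m → g' • m = m :=
    fun g' hg' h => hT.1.eq_of_btw (hM g' hg').1 hm h
  have h1 : T.graph.dist x (g • m) = T.graph.dist x m + 1 := by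
    have h2 := hM g hg
    by_contra hc
    exact hne (hodd g hg (by omega))
  have hgg : g • g • m = m := by
    rw [← mul_smul]
    apply hodd _ (H.mul_mem hg hg)
    have h2 := hM _ (H.mul_mem hg hg)
    by_contra hc
    have h4 : g • g • m = g • m := by
      rw [← mul_smul]
      refine hT.1.eq_of_btw h2.1 (hM g hg).1 ?_
      omega
    exact hne (MulAction.injective g h4)
  have hadj : T.graph.Adj m (g • m) := by
    rw [← dist_eq_one_iff_adj]
    have h3 := (hT.1.btw_of_le (hM g hg).1 hm (by omega)).1
    unfold SimpleGraph.Btw at h3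
    omega
  exact hT.2 g m (g • m) hadj ⟨rfl, hgg⟩

end ActionGraph

/-! ### The groups BS(1,s): normal forms and representations. -/

namespace BS1

theorem relation (s : ℤ) : (PresentedGroup.of 1 : BS1 s) * PresentedGroup.of 0 *
    (PresentedGroup.of 1)⁻¹ = PresentedGroup.of 0 ^ s := by
  have : (PresentedGroup.mk _ (FreeGroup.of 1 * FreeGroup.of 0 * (FreeGroup.of 1)⁻¹ *
      (FreeGroup.of 0 ^ s)⁻¹) : BS1 s) = 1 := by
    rw [PresentedGroup.one_of_mem]
    rfl
  rw [map_mul, map_inv, mul_inv_eq_one] at this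
  simp only [map_mul, map_inv, map_zpow] at this
  exact this

theorem conj_pow {H : Type*} [Group H] {a t : H} {s : ℤ} (h : t * a * t⁻¹ = a ^ s) (i : ℕ) (l : ℤ) :
    t ^ i * a ^ l * (t ^ i)⁻¹ = a ^ (s ^ i * l) := by
  induction i with
  | zero => simp
  | succ i ih =>
    have h1 : ∀ m : ℤ, t * a ^ m * t⁻¹ = a ^ (s * m) := fun m => by
      rw [zpow_mul, ← h, conj_zpow]
    calc t ^ (i + 1) * a ^ l * (t ^ (i + 1))⁻¹ = t * (t ^ i * a ^ l * (t ^ i)⁻¹) * t⁻¹ := by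
          rw [pow_succ']; group
      _ = _ := by rw [ih, h1, pow_succ', mul_assoc]

/-- The set of products `t⁻ⁱ aˡ tʲ` is closed under left multiplication by `a` and `t`. -/
theorem normal_form_of_mem_closure {H : Type*} [Group H] {a t : H} {s : ℤ}
    (h : t * a * t⁻¹ = a ^ s) {g : H} (hg : g ∈ Subgroup.closure {a, t}) :
    ∃ (i j : ℕ) (l : ℤ), g = (t ^ i)⁻¹ * a ^ l * t ^ j := by
  have hmul : ∀ (n : ℤ) (i j : ℕ) (l : ℤ), ∃ (i' j' : ℕ) (l' : ℤ),
      a ^ n * ((t ^ i)⁻¹ * a ^ l * t ^ j) = (t ^ i')⁻¹ * a ^ l' * t ^ j' := fun n i j l => by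
    refine ⟨i, j, s ^ i * n + l, ?_⟩
    rw [zpow_add, ← conj_pow h]
    group
  induction hg using Subgroup.closure_induction_left with
  | one => exact ⟨0, 0, 0, by simp⟩
  | mul_left x hx y _ ih =>
    obtain ⟨i, j, l, rfl⟩ := ih
    rcases hx with rfl | rfl
    · simpa using hmul 1 i j l
    · cases i with
      | zero =>
        refine ⟨0, j + 1, s * l, ?_⟩
        have := conj_pow h 1 l
        simp only [pow_one] at this
        rw [← this, pow_succ']
        group
      | succ i => exact ⟨i, j, l, by rw [pow_succ]; group⟩
  | inv_mul_cancel x hx y _ ih =>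
    obtain ⟨i, j, l, rfl⟩ := ih
    rcases hx with rfl | rfl
    · simpa using hmul (-1) i j l
    · exact ⟨i + 1, j, l, by rw [pow_succ]; group⟩

theorem closure_eq_top (s : ℤ) :
    Subgroup.closure {(PresentedGroup.of 0 : BS1 s), PresentedGroup.of 1} = ⊤ := by
  rw [← PresentedGroup.closure_range_of]
  congr 1
  ext x
  simp only [Set.mem_insert_iff, Set.mem_singleton_iff, Set.mem_range, Fin.exists_fin_two]
  tauto

/-- The homomorphism from `BS(1,s)` given by two elements satisfying the relation. -/
def lift {H : Type*} [Group H] {a t : H} {s : ℤ} (h : t * a * t⁻¹ = a ^ s) : BS1 s →* H :=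
  PresentedGroup.toGroup (f := ![a, t]) (by
    rintro r rfl
    simp [h])

theorem lift_of_zero {H : Type*} [Group H] {a t : H} {s : ℤ} (h : t * a * t⁻¹ = a ^ s) :
    lift h (PresentedGroup.of 0) = a := by simp [lift]

theorem lift_of_one {H : Type*} [Group H] {a t : H} {s : ℤ} (h : t * a * t⁻¹ = a ^ s) :
    lift h (PresentedGroup.of 1) = t := by simp [lift]

theorem addRight_one_zpow (n : ℤ) :
    (Equiv.addRight 1 : Equiv.Perm ℚ) ^ n = Equiv.addRight (n : ℚ) := by
  induction n using Int.induction_on with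
  | zero => ext; simp
  | succ n ih => rw [zpow_add_one, ih]; ext; simp; ring
  | pred n ih => rw [zpow_sub_one, ih]; ext; simp; ring

/-- BS(1,s) acts affinely on `ℚ`, with `a` acting as translation by 1 and `t` as multiplication by
`s`. -/
theorem of_zero_ne_one {s : ℤ} (hs : s ≠ 0) : (PresentedGroup.of 0 : BS1 s) ≠ 1 := by
  intro h
  have hs' : (s : ℚ) ≠ 0 := Int.cast_ne_zero.2 hs
  have hrel : (Equiv.mulLeft₀ (s : ℚ) hs' : Equiv.Perm ℚ) * Equiv.addRight 1 *
      (Equiv.mulLeft₀ (s : ℚ) hs')⁻¹ = Equiv.addRight 1 ^ s := by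
    rw [mul_inv_eq_iff_eq_mul, addRight_one_zpow]
    ext x
    simp [mul_add]
  have h1 := lift_of_zero hrel
  rw [h, map_one] at h1
  have := congrArg (fun f : Equiv.Perm ℚ => f 0) h1
  simp at this

/-- The homomorphism to the integers killing `a` and sending `t` to 1 detects the exponent of `t`.
-/
theorem eq_zero_of_zpow_eq {m l : ℤ}
    (h : (PresentedGroup.of 0 : BS1 1) ^ m = PresentedGroup.of 1 ^ l) : l = 0 := by
  have hrel : (Multiplicative.ofAdd (1 : ℤ)) * 1 * (Multiplicative.ofAdd (1 : ℤ))⁻¹ = 1 ^ (1 : ℤ) := by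
    simp
  have h1 := congrArg (lift hrel) h
  rw [map_zpow, map_zpow, lift_of_zero, lift_of_one, one_zpow, ← ofAdd_zsmul] at h1
  simpa using (congrArg Multiplicative.toAdd h1).symm

end BS1

theorem isSolvableBS_of_normal_form {H : Type u} [Group H] {a t : H} {s : ℤ} (hs : s ≠ 0)
    (h : t * a * t⁻¹ = a ^ s)
    (hsurj : ∀ g : H, ∃ (i j : ℕ) (l : ℤ), g = (t ^ i)⁻¹ * a ^ l * t ^ j)
    (hinj : ∀ (i j : ℕ) (l : ℤ), (t ^ i)⁻¹ * a ^ l * t ^ j = 1 → i = j ∧ l = 0) :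
    IsSolvableBS H := by
  refine ⟨s, hs, ⟨(MulEquiv.ofBijective (BS1.lift h) ⟨?_, fun g => ?_⟩).symm⟩⟩
  · rw [injective_iff_map_eq_one]
    intro g hg
    obtain ⟨i, j, l, rfl⟩ := BS1.normal_form_of_mem_closure (BS1.relation s) (g := g)
      (by rw [BS1.closure_eq_top]; trivial)
    simp only [map_mul, map_inv, map_pow, map_zpow, BS1.lift_of_zero, BS1.lift_of_one] at hg
    obtain ⟨rfl, rfl⟩ := hinj i j l hg
    simp
  · obtain ⟨i, j, l, rfl⟩ := hsurj g
    refine ⟨(PresentedGroup.of 1 ^ i)⁻¹ * PresentedGroup.of 0 ^ l * PresentedGroup.of 1 ^ j, ?_⟩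
    simp only [map_mul, map_inv, map_pow, map_zpow, BS1.lift_of_zero, BS1.lift_of_one]

/-- The last clause records that BS(1,1) has rank two: it later guarantees that a product of powers
of `a` and `t` acting trivially on the tail of an axis is a non-trivial element. -/
theorem IsSolvableBS.exists_generators {G : Type u} [Group G] {H : Subgroup G}
    (hH : IsSolvableBS H) : ∃ (s : ℤ) (a t : G), s ≠ 0 ∧ a ∈ H ∧ t ∈ H ∧ a ≠ 1 ∧
      t * a * t⁻¹ = a ^ s ∧ Subgroup.closure {a, t} = H ∧
      (s = 1 → ∀ m l : ℤ, a ^ m = t ^ l → l = 0) := by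
  obtain ⟨s, hs, ⟨e⟩⟩ := hH
  have hclos : Subgroup.closure {((e.symm (PresentedGroup.of 0) : H) : G),
      ((e.symm (PresentedGroup.of 1) : H) : G)} = H := by
    have h1 := congrArg (Subgroup.map (H.subtype.comp e.symm.toMonoidHom)) (BS1.closure_eq_top s)
    rw [MonoidHom.map_closure, ← MonoidHom.range_eq_map, Set.image_pair] at h1
    refine h1.trans ?_
    rw [MonoidHom.range_comp, MonoidHom.range_eq_top.2 e.symm.surjective, ← MonoidHom.range_eq_map,
      Subgroup.range_subtype]
  refine ⟨s, (e.symm (PresentedGroup.of 0) : H), (e.symm (PresentedGroup.of 1) : H), hs,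
    SetLike.coe_mem _, SetLike.coe_mem _, ?_, ?_, hclos, ?_⟩
  · simpa using BS1.of_zero_ne_one hs
  · have := congrArg (fun x => ((e.symm x : H) : G)) (BS1.relation s)
    simpa using this
  · rintro rfl m l h
    refine BS1.eq_zero_of_zpow_eq (m := m) (e.symm.injective ?_)
    apply Subtype.ext
    simpa using h

/-! ### Torsion-free commutative transitive groups. -/

section TorsionFree

variable {G : Type u} [Group G]

theorem zpow_ne_one_of_torsionFree (htf : ∀ g : G, g ≠ 1 → ¬ IsOfFinOrder g) {g : G} (hg : g ≠ 1)
    {n : ℤ} (hn : n ≠ 0) : g ^ n ≠ 1 := fun h =>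
  htf g hg (isOfFinOrder_iff_zpow_eq_one.2 ⟨n, hn, h⟩)

namespace IsCommutativeTransitive

theorem commute_of_commute (hct : IsCommutativeTransitive G) {a x y : G} (ha : a ≠ 1)
    (hx : Commute x a) (hy : Commute y a) : Commute x y := by
  by_cases h1 : x = 1
  · rw [h1]; exact Commute.one_left y
  by_cases h2 : y = 1
  · rw [h2]; exact Commute.one_right x
  exact hct x a y h1 ha h2 hx hy.symm

theorem commute_of_commute_zpow (hct : IsCommutativeTransitive G)
    (htf : ∀ g : G, g ≠ 1 → ¬ IsOfFinOrder g) {a c : G} {n : ℤ} (hn : n ≠ 0)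
    (h : Commute c (a ^ n)) : Commute c a := by
  by_cases ha : a = 1
  · rw [ha]; exact Commute.one_right c
  exact hct.commute_of_commute (zpow_ne_one_of_torsionFree htf ha hn) h
    ((Commute.refl a).zpow_right n)

/-- An element normalizing an infinite cyclic group centralizes it. -/
theorem commute_of_normalizes (hct : IsCommutativeTransitive G)
    (htf : ∀ g : G, g ≠ 1 → ¬ IsOfFinOrder g) {b g : G}
    (h : g * b * g⁻¹ ∈ Subgroup.zpowers b) (h' : g⁻¹ * b * g ∈ Subgroup.zpowers b) :
    Commute g b := by
  by_cases hb : b = 1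
  · rw [hb]; exact Commute.one_right g
  obtain ⟨m, hm⟩ := h
  obtain ⟨n, hn⟩ := h'
  simp only at hm hn
  have h1 : b ^ (m * n) = b ^ (1 : ℤ) := by
    rw [zpow_mul, hm, conj_zpow, hn]
    group
  -- Conjugation by `g` is an automorphism of an infinite cyclic group, so it is the identity or
  -- inversion. Inversion is excluded because `g ^ 2` would commute with `b`, and then so would `g`.
  have hmn : m * n = 1 := by
    by_contra hne
    apply zpow_ne_one_of_torsionFree htf hb (sub_ne_zero.2 hne)
    rw [zpow_sub, h1, mul_inv_cancel]
  rcases Int.eq_one_or_neg_one_of_mul_eq_one hmn with rfl | rfl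
  · rw [zpow_one, eq_mul_inv_iff_mul_eq] at hm
    exact hm.symm
  · rw [zpow_neg_one] at hm
    by_cases hg : g = 1
    · rw [hg]; exact Commute.one_left b
    have h2 : Commute b (g ^ (2 : ℤ)) := by
      have h3 : g * (g * b * g⁻¹) * g⁻¹ = b := by
        rw [← hm]
        have : g * b⁻¹ * g⁻¹ = (g * b * g⁻¹)⁻¹ := by group
        rw [this, ← hm, inv_inv]
      have h4 : g ^ (2 : ℤ) * b = b * g ^ (2 : ℤ) := by
        rw [zpow_two]
        calc g * g * b = (g * (g * b * g⁻¹) * g⁻¹) * (g * g) := by group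
          _ = _ := by rw [h3]
      exact h4.symm
    exact (hct.commute_of_commute_zpow htf two_ne_zero h2).symm

end IsCommutativeTransitive

theorem exists_generator {K : Subgroup G} (h : IsCyclic K) : ∃ b, K = Subgroup.zpowers b :=
  (Subgroup.isCyclic_iff_exists_zpowers_eq_top K).1 h |>.imp fun _ h => h.symm

theorem commute_of_mem_of_isCyclic {K : Subgroup G} (h : IsCyclic K) {x y : G} (hx : x ∈ K)
    (hy : y ∈ K) : Commute x y := by
  obtain ⟨b, rfl⟩ := exists_generator h
  obtain ⟨m, rfl⟩ := hx
  obtain ⟨n, rfl⟩ := hy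
  exact (Commute.refl b).zpow_zpow m n

theorem exists_zpow_eq_zpow_of_isCyclic {K : Subgroup G} (h : IsCyclic K) {x y : G} (hx : x ∈ K)
    (hy : y ∈ K) (hx1 : x ≠ 1) (hy1 : y ≠ 1) :
    ∃ m n : ℤ, m ≠ 0 ∧ n ≠ 0 ∧ x ^ m = y ^ n := by
  obtain ⟨b, rfl⟩ := exists_generator h
  obtain ⟨m, rfl⟩ := hx
  obtain ⟨n, rfl⟩ := hy
  refine ⟨n, m, ?_, ?_, ?_⟩
  · rintro rfl; simp at hy1
  · rintro rfl; simp at hx1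
  · simp only [← zpow_mul, mul_comm]

end TorsionFree

namespace ActionGraph

open SimpleGraph

variable {G : Type u} [Group G] {T : ActionGraph.{u, v} G}

/-! ### Elements shifting a ray -/

/-- The element `g` shifts the ray `r` by `d`, eventually. -/
def HasShift (r : ℕ → T.V) (g : G) (d : ℤ) : Prop :=
  ∃ i j : ℕ, (j : ℤ) - i = d ∧ ∀ n, g • r (n + i) = r (n + j)

namespace HasShift

variable {r : ℕ → T.V} {g g' : G} {d d' : ℤ}

theorem one : HasShift r (1 : G) 0 := ⟨0, 0, by simp, fun n => one_smul G _⟩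

theorem mul (h : HasShift r g d) (h' : HasShift r g' d') : HasShift r (g * g') (d + d') := by
  obtain ⟨i, j, rfl, h⟩ := h
  obtain ⟨i', j', rfl, h'⟩ := h'
  refine ⟨i + i', j' + j, by push_cast; ring, fun n => ?_⟩
  rw [mul_smul, ← add_assoc, h', add_assoc, add_comm i, ← add_assoc, h, ← add_assoc]

theorem inv (h : HasShift r g d) : HasShift r g⁻¹ (-d) := by
  obtain ⟨i, j, rfl, h⟩ := h
  exact ⟨j, i, by ring, fun n => by rw [inv_smul_eq_iff, h]⟩

theorem pow (h : HasShift r g d) (n : ℕ) : HasShift r (g ^ n) (n * d) := by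
  induction n with
  | zero => simpa using one
  | succ n ih =>
    rw [pow_succ]
    convert ih.mul h using 1
    push_cast
    ring

theorem zpow (h : HasShift r g d) (n : ℤ) : HasShift r (g ^ n) (n * d) := by
  obtain ⟨n, rfl | rfl⟩ := n.eq_nat_or_neg
  · rw [zpow_natCast]; exact h.pow n
  · rw [zpow_neg, zpow_natCast, neg_mul]; exact (h.pow n).inv

theorem eventually_fixed (h : HasShift r g 0) : ∃ N, ∀ n, N ≤ n → g • r n = r n := by
  obtain ⟨i, j, hij, h⟩ := h
  obtain rfl : i = j := by omega
  refine ⟨i, fun n hn => ?_⟩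
  have := h (n - i)
  rwa [Nat.sub_add_cancel hn] at this

end HasShift

theorem ray_injective {r : ℕ → T.V} (hr : ∀ m n, m ≤ n → T.graph.dist (r m) (r n) = n - m) :
    Function.Injective r := by
  have key : ∀ m n, m ≤ n → r m = r n → m = n := fun m n hmn h => by
    have := hr m n hmn
    rw [h, dist_self] at this
    omega
  intro m n h
  rcases le_total m n with h' | h'
  · exact key m n h' h
  · exact (key n m h' h.symm).symm

theorem ray_btw {r : ℕ → T.V} (hr : ∀ m n, m ≤ n → T.graph.dist (r m) (r n) = n - m)
    {a b c : ℕ} (h : a ≤ b) (h' : b ≤ c) : T.graph.Btw (r a) (r b) (r c) := by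
  unfold SimpleGraph.Btw
  rw [hr _ _ h, hr _ _ h', hr _ _ (h.trans h')]
  omega

theorem HasShift.unique {r : ℕ → T.V}
    (hr : ∀ m n, m ≤ n → T.graph.dist (r m) (r n) = n - m) {g : G} {d d' : ℤ}
    (h : HasShift r g d) (h' : HasShift r g d') :
    d = d' := by
  obtain ⟨i, j, rfl, h⟩ := h
  obtain ⟨i', j', rfl, h'⟩ := h'
  have h1 := h i'
  have h2 := h' i
  rw [add_comm i i', h1] at h2
  have := ray_injective hr h2
  omega

/-- An element shifting a ray non-trivially fixes no vertex. -/
theorem HasShift.eq_zero_of_fixed {r : ℕ → T.V}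
    (hr : ∀ m n, m ≤ n → T.graph.dist (r m) (r n) = n - m) (hT : T.graph.IsTree) {g : G} {d : ℤ}
    (h : HasShift r g d) {z : T.V} (hz : g • z = z) : d = 0 := by
  have key : ∀ (g : G) (d : ℤ), HasShift r g d → g • z = z → d ≤ 0 := by
    intro g d h hz
    by_contra hd
    obtain ⟨i, j, rfl, h⟩ := h
    have h1 : g • r i = r j := by simpa using h 0
    have h2 : g • g • r i = r (j - i + j) := by
      rw [h1, ← h]
      congr 2
      omega
    -- A positive shift makes `r i`, `g • r i`, `g • g • r i` successive points of the ray, so `g`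
    -- has an axis through `r i`.
    refine zpow_smul_ne_of_axis hT (y := r i) (h := g) ?_ ?_ one_ne_zero z (by simpa using hz)
    · rw [h1]
      intro he
      have := ray_injective hr he
      omega
    · rw [h2, h1]
      exact ray_btw hr (by omega) (by omega)
  have h1 := key g d h hz
  have h2 := key g⁻¹ (-d) h.inv (by rw [inv_smul_eq_iff, hz])
  omega

/-- A torsion-free group fixing an end of a tree, not acting by elliptic elements only, and such
that the vertices of a ray going to this end have infinite cyclic stabilizers, is a solvable
Baumslag–Solitar group. -/
theorem isSolvableBS_of_hasShift {r : ℕ → T.V}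
    (hr : ∀ m n, m ≤ n → T.graph.dist (r m) (r n) = n - m) (htf : ∀ g : G, g ≠ 1 → ¬ IsOfFinOrder g)
    (hT : T.graph.IsTree) {H : Subgroup G} (hH : ∀ g ∈ H, ∃ d, HasShift r g d)
    (hne : ∃ g ∈ H, ∃ d, d ≠ 0 ∧ HasShift r g d)
    (hcyc : ∀ n, IsCyclic (MulAction.stabilizer G (r n) ⊓ H : Subgroup G))
    (hnt : ∀ n, ∃ g ∈ H, g ≠ 1 ∧ g • r n = r n) : IsSolvableBS H := by
  -- The shift is a homomorphism from `H` to the integers; `t` realizes its least positive value.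
  obtain ⟨t, m, ⟨htH, hm, htm⟩, hmin⟩ : ∃ (t : G) (m : ℕ), (t ∈ H ∧ 0 < m ∧ HasShift r t m) ∧
      ∀ (g : G) (k : ℕ), g ∈ H → 0 < k → HasShift r g k → m ≤ k := by
    have hex : ∃ m : ℕ, ∃ t ∈ H, 0 < m ∧ HasShift r t m := by
      obtain ⟨g, hg, d, hd, h⟩ := hne
      rcases lt_or_gt_of_ne hd with h1 | h1
      · refine ⟨(-d).toNat, g⁻¹, H.inv_mem hg, by omega, ?_⟩
        rw [Int.toNat_of_nonneg (by omega)]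
        exact h.inv
      · refine ⟨d.toNat, g, hg, by omega, ?_⟩
        rw [Int.toNat_of_nonneg (by omega)]
        exact h
    classical
    obtain ⟨t, h1, h2, h3⟩ := Nat.find_spec hex
    exact ⟨t, Nat.find hex, ⟨h1, h2, h3⟩, fun g k hg hk h => Nat.find_min' hex ⟨g, hg, hk, h⟩⟩
  obtain ⟨i, j, hij, ht⟩ := htm
  obtain rfl : j = i + m := by omega
  have htm : HasShift r t m := ⟨i, i + m, hij, ht⟩
  have htk : ∀ k : ℕ, t ^ k • r i = r (i + k * m) := fun k => by
    induction k with
    | zero => simp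
    | succ k ih =>
      rw [pow_succ', mul_smul, ih, add_comm i, ht]
      congr 1
      ring
  obtain ⟨b, hb⟩ := exists_generator (hcyc i)
  have hmem : ∀ g, g ∈ H → g • r i = r i → g ∈ Subgroup.zpowers b := fun g hg h => by
    rw [← hb]; exact ⟨h, hg⟩
  obtain ⟨hbi, hbH⟩ : b • r i = r i ∧ b ∈ H := by
    have : b ∈ MulAction.stabilizer G (r i) ⊓ H := by rw [hb]; exact Subgroup.mem_zpowers b
    exact this
  have hb1 : b ≠ 1 := by
    rintro rfl
    obtain ⟨g, hg, hg1, h⟩ := hnt i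
    have := hmem g hg h
    rw [Subgroup.zpowers_one_eq_bot, Subgroup.mem_bot] at this
    exact hg1 this
  have hb0 : HasShift r b 0 := by
    obtain ⟨d, hd⟩ := hH b hbH
    rwa [hd.eq_zero_of_fixed hr hT hbi] at hd
  have hbn : ∀ n, i ≤ n → b • r n = r n := fun n hn => by
    obtain ⟨N, hN⟩ := hb0.eventually_fixed
    exact smul_eq_of_btw hT hbi (hN (max N n) (le_max_left _ _))
      (ray_btw hr hn (le_max_right _ _))
  -- The generator `b` fixes the whole ray beyond `r i`, in particular `t • r i`; so its conjugate
  -- fixes `r i`.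
  obtain ⟨s, hs⟩ : t⁻¹ * b * t ∈ Subgroup.zpowers b := by
    refine hmem _ (H.mul_mem (H.mul_mem (H.inv_mem htH) hbH) htH) ?_
    have h1 := htk 1
    rw [pow_one] at h1
    rw [mul_smul, h1, mul_smul, inv_smul_eq_iff, h1, hbn _ (by omega)]
  simp only at hs
  have hs0 : s ≠ 0 := by
    rintro rfl
    rw [zpow_zero] at hs
    apply hb1
    have : b = t * (t⁻¹ * b * t) * t⁻¹ := by group
    rw [this, ← hs]
    simp
  -- The stable letter is `t⁻¹`: conjugation by it, towards the beginning of the ray, sends `b` to a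
  -- power of itself.
  refine isSolvableBS_of_normal_form (a := ⟨b, hbH⟩) (t := ⟨t⁻¹, H.inv_mem htH⟩) hs0
    (Subtype.ext (by simpa using hs.symm)) ?_ ?_
  · rintro ⟨g, hg⟩
    obtain ⟨d, hd⟩ := hH g hg
    have h1 := hd.mul (htm.zpow (-(d / m)))
    have h2 : d + -(d / m) * m = d % m := by
      have := Int.emod_add_mul_ediv d m
      linarith [mul_comm (d / m) (m : ℤ)]
    rw [h2] at h1
    have h3 : d % m = 0 := by
      by_contra hne
      have h4 : 0 ≤ d % m := Int.emod_nonneg _ (by omega)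
      have h5 : d % m < m := Int.emod_lt_of_pos _ (by omega)
      have h6 := hmin _ (d % m).toNat (H.mul_mem hg (H.zpow_mem htH _)) (by omega)
        (by rwa [Int.toNat_of_nonneg h4])
      omega
    rw [h3] at h1
    obtain ⟨N, hN⟩ := h1.eventually_fixed
    generalize d / m = k at h1 hN
    -- The bound by `N` brings the element of shift zero into the stabilizer of `r i` after
    -- conjugation by `t ^ e`; the bound by `k` makes the last exponent of the normal form a natural
    -- number.
    obtain ⟨e, he1, he2⟩ : ∃ e : ℕ, N ≤ i + e * m ∧ k ≤ e := by
      refine ⟨N + k.toNat, ?_, by omega⟩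
      have : N + k.toNat ≤ (N + k.toNat) * m := Nat.le_mul_of_pos_right _ hm
      omega
    have h7 := hN _ he1
    rw [← htk] at h7
    obtain ⟨l, hl⟩ : (t ^ e)⁻¹ * (g * t ^ (-k)) * t ^ e ∈ Subgroup.zpowers b := by
      refine hmem _ (H.mul_mem (H.mul_mem (H.inv_mem (H.pow_mem htH _))
        (H.mul_mem hg (H.zpow_mem htH _))) (H.pow_mem htH _)) ?_
      rw [mul_smul, mul_smul, h7, inv_smul_eq_iff]
    simp only at hl
    refine ⟨e, (e - k).toNat, l, Subtype.ext ?_⟩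
    simp only [Subgroup.coe_mul, InvMemClass.coe_inv, SubmonoidClass.coe_pow, Subgroup.coe_zpow]
    rw [hl, ← zpow_natCast _ (e - k).toNat, Int.toNat_of_nonneg (by omega), inv_pow, inv_inv,
      inv_zpow, ← zpow_neg]
    have : t ^ (-(e - k)) = (t ^ e)⁻¹ * t ^ k := by
      rw [neg_sub, zpow_sub, zpow_natCast]
      exact (((Commute.refl t).zpow_left k).pow_right e).inv_right.eq
    rw [this]
    group
  · intro p q l h
    have h' := congrArg Subtype.val h
    simp only [Subgroup.coe_mul, InvMemClass.coe_inv, SubmonoidClass.coe_pow, Subgroup.coe_zpow,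
      Subgroup.coe_one] at h'
    have h1 := ((htm.inv.pow p).inv.mul (hb0.zpow l)).mul (htm.inv.pow q)
    rw [h'] at h1
    have h2 := h1.unique hr HasShift.one
    have h3 : (p : ℤ) * m = q * m := by linarith
    have h4 : p = q := by
      have := mul_right_cancel₀ (by omega : (m : ℤ) ≠ 0) h3
      omega
    subst h4
    refine ⟨rfl, ?_⟩
    by_contra hl
    apply zpow_ne_one_of_torsionFree htf hb1 hl
    rw [mul_assoc, inv_mul_eq_one] at h'
    exact mul_eq_right.1 h'.symm

end ActionGraph

/-! ### Rays in axes, finite generation, and stabilizers of pairs of vertices. -/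

namespace ActionGraph

open SimpleGraph

variable {G : Type u} [Group G] {T : ActionGraph.{u, v} G}

/-- An axis contains a ray, which is shifted by all elements of the centralizer. -/
theorem exists_axis_ray (hT : T.graph.IsTree) {h : G} {y : T.V} (hne : h • y ≠ y)
    (hb : T.graph.Btw y (h • y) (h • h • y)) :
    ∃ r : ℕ → T.V, (∀ m n, m ≤ n → T.graph.dist (r m) (r n) = n - m) ∧
      (∀ n, ∃ k : ℕ, T.graph.Btw y (r n) (h ^ k • y)) ∧
      (∀ k : ℕ, r (k * T.graph.dist y (h • y)) = h ^ k • y) ∧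
      HasShift r h (T.graph.dist y (h • y)) ∧ ∀ c, Commute c h → ∃ d, HasShift r c d := by
  have hpos : 0 < T.graph.dist y (h • y) := hT.dist_pos hne.symm
  obtain ⟨r, hr0, hr, hr1, -⟩ := hT.exists_ray y (fun k : ℕ => h ^ k • y)
    (fun k => {v | ∃ l, k ≤ l ∧ v = h ^ l • y})
    (by rintro k _ ⟨l, hl, rfl⟩; exact btw_pow_smul hT hne hb hl)
    (fun i j => ⟨h ^ (max i j) • y, ⟨_, le_max_left _ _, rfl⟩, ⟨_, le_max_right _ _, rfl⟩⟩)
    (fun n => ⟨n, by rw [(dist_pow_smul hT hne hb n).1]; exact Nat.le_mul_of_pos_right _ hpos⟩)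
  have hdist : ∀ n, T.graph.dist y (r n) = n := fun n => by
    have := hr 0 n (Nat.zero_le n)
    rwa [hr0, Nat.sub_zero] at this
  have hshift : ∀ n, h • r n = r (n + T.graph.dist y (h • y)) := fun n => by
    obtain ⟨k, hk⟩ := hr1 n
    obtain ⟨l, hl⟩ := hr1 (n + T.graph.dist y (h • y))
    have h1 := btw_smul hT h hk
    rw [← mul_smul, ← pow_succ'] at h1
    have h2 : T.graph.Btw y (h • y) (h ^ (k + 1) • y) := by
      simpa using btw_pow_smul hT hne hb (Nat.le_add_left 1 k)
    have h3 := hT.btw_trans h1.symm h2.symm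
    have h4 := (hT.btw_trans h3.1.symm (btw_pow_smul hT hne hb (le_max_left (k + 1) l))).1
    have h5 := (hT.btw_trans hl (btw_pow_smul hT hne hb (le_max_right (k + 1) l))).1
    refine hT.eq_of_btw h4 h5 ?_
    have h6 := h3.2.symm
    unfold SimpleGraph.Btw at h6
    rw [dist_smul hT, hdist] at h6
    rw [hdist]
    omega
  have hpow : ∀ k : ℕ, r (k * T.graph.dist y (h • y)) = h ^ k • y := fun k => by
    induction k with
    | zero => simpa using hr0
    | succ k ih => rw [pow_succ', mul_smul, ← ih, hshift, Nat.succ_mul]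
  refine ⟨r, hr, hr1, hpow, ⟨0, T.graph.dist y (h • y), by simp, hshift⟩, fun c hc => ?_⟩
  rcases hT.ray_dichotomy (r' := fun n => c • r n) hr
    (fun m n hmn => by rw [dist_smul hT]; exact hr m n hmn) with ⟨i, j, hij⟩ | ⟨N, K, hNK⟩
  · exact ⟨_, i, j, rfl, hij⟩
  · exfalso
    -- Since `c` commutes with `h`, it moves every `h ^ k • y` by the same distance, whereas
    -- separation at `r N` would make the displacement grow along the ray.
    set k := N + K + T.graph.dist y (c • y) + 1 with hk
    have hle : k ≤ k * T.graph.dist y (h • y) := Nat.le_mul_of_pos_right _ hpos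
    have h1 := hNK (k * T.graph.dist y (h • y)) (k * T.graph.dist y (h • y)) (by omega) (by omega)
    have h2 := hr N (k * T.graph.dist y (h • y)) (by omega)
    rw [dist_comm] at h2
    have h3 : T.graph.dist (r (k * T.graph.dist y (h • y)))
        (c • r (k * T.graph.dist y (h • y))) = T.graph.dist y (c • y) := by
      rw [hpow, ← mul_smul, (hc.pow_right k).eq, mul_smul, dist_smul hT]
    unfold SimpleGraph.Btw at h1
    omega

/-- For a finitely generated group, the edges of the segments `[x, g x]` fall into finitely many
orbits. -/
theorem finite_orbits_of_fg (hfg : Group.FG G) (hT : T.graph.IsTree) (x : T.V) :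
    ∃ P : Set (T.V × T.V), P.Finite ∧ ∀ (g : G) (p q : T.V), T.graph.Adj p q →
      T.graph.Btw x p (g • x) → T.graph.Btw x q (g • x) → ∃ h : G, (h • p, h • q) ∈ P := by
  obtain ⟨S, hS⟩ := (Monoid.fg_def.1 (Group.fg_iff_monoid_fg.1 hfg))
  refine ⟨⋃ s ∈ S, {z | T.graph.Btw x z (s • x)} ×ˢ {z | T.graph.Btw x z (s • x)},
    S.finite_toSet.biUnion fun s _ => (hT.finite_btw _ _).prod (hT.finite_btw _ _), fun g => ?_⟩
  have hg : g ∈ Submonoid.closure (S : Set G) := by rw [hS]; trivial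
  induction hg using Submonoid.closure_induction_right with
  | one =>
    intro p q hadj hp hq
    rw [one_smul] at hp hq
    unfold SimpleGraph.Btw at hp hq
    rw [dist_self] at hp hq
    have h1 : x = p := hT.eq_of_dist (by omega)
    have h2 : x = q := hT.eq_of_dist (by omega)
    exact absurd (h1.symm.trans h2) hadj.ne
  | mul_right g _ s hs ih =>
    intro p q hadj hp hq
    -- The median of the three points cuts the geodesic from `x` to `(g * s) • x` into a part of
    -- each of the other two sides; an edge cannot straddle this vertex.
    have hcase : (T.graph.Btw x p (g • x) ∧ T.graph.Btw x q (g • x)) ∨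
        (T.graph.Btw (g • x) p ((g * s) • x) ∧ T.graph.Btw (g • x) q ((g * s) • x)) := by
      obtain ⟨m, h1, h2, h3⟩ := hT.exists_median x (g • x) ((g * s) • x)
      have hd : T.graph.dist x p ≠ T.graph.dist x q := fun he =>
        hadj.ne (hT.eq_of_btw hp hq he)
      have hd' : T.graph.dist p q = 1 := dist_eq_one_iff_adj.2 hadj
      have h4 := hT.tri x p q
      have h5 := hT.tri x q p
      rw [dist_comm (u := q)] at h5
      by_cases hle : T.graph.dist x p ≤ T.graph.dist x m ∧ T.graph.dist x q ≤ T.graph.dist x m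
      · exact Or.inl ⟨(hT.btw_trans (hT.btw_of_le h3 hp hle.1).1 h1).1,
          (hT.btw_trans (hT.btw_of_le h3 hq hle.2).1 h1).1⟩
      · have h6 := (hT.btw_of_le hp h3 (by omega)).2
        have h7 := (hT.btw_of_le hq h3 (by omega)).2
        exact Or.inr ⟨(hT.btw_trans h6.symm h2.symm).1.symm,
          (hT.btw_trans h7.symm h2.symm).1.symm⟩
    rcases hcase with ⟨h1, h2⟩ | ⟨h1, h2⟩
    · exact ih p q hadj h1 h2
    · refine ⟨g⁻¹, Set.mem_biUnion hs ⟨?_, ?_⟩⟩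
      · simpa [mul_smul] using btw_smul hT g⁻¹ h1
      · simpa [mul_smul] using btw_smul hT g⁻¹ h2

/-- In a tree with cyclic edge stabilizers, the pointwise stabilizer of two distinct vertices is
cyclic. -/
theorem isCyclic_of_fixes (hT : T.IsCyclicTree) {K : Subgroup G} {u v : T.V} (huv : u ≠ v)
    (hu : ∀ g ∈ K, g • u = u) (hv : ∀ g ∈ K, g • v = v) : IsCyclic K := by
  obtain ⟨n, hn, hd⟩ := hT.1.1.exists_adj_closer huv
  have hb : T.graph.Btw u n v := by
    have : T.graph.dist n v = 1 := dist_eq_one_iff_adj.2 hn.symm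
    unfold SimpleGraph.Btw
    omega
  have hle : K ≤ T.edgeStab s(v, n) := by
    intro g hg
    rw [edgeStab, mem_fixingSubgroup_iff]
    intro z hz
    rcases Sym2.mem_iff.1 hz with rfl | rfl
    · exact hv g hg
    · exact smul_eq_of_btw hT.1.1 (hu g hg) (hv g hg) hb
  have := (hT.2 s(v, n) hn).1
  exact Subgroup.isCyclic_of_le hle

/-! ### The virtual normalizer of a cyclic group: fixed vertex or BS(1,s). -/

section VirtualNormalizer

/-- The subgroup `H` consists of the elements conjugating `a` to an element commensurable
with `a`. -/
def IsVirtualNormalizer (H : Subgroup G) (a : G) : Prop :=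
  ∀ g, g ∈ H ↔ ∃ m n : ℤ, m ≠ 0 ∧ n ≠ 0 ∧ g * a ^ m * g⁻¹ = a ^ n

variable {H : Subgroup G} {a : G}

theorem IsVirtualNormalizer.mem_of_commute (hH : IsVirtualNormalizer H a) {c : G}
    (hc : Commute c a) : c ∈ H := by
  refine (hH c).2 ⟨1, 1, one_ne_zero, one_ne_zero, ?_⟩
  rw [zpow_one, hc.eq, mul_inv_cancel_right]

/-- This is normality in `H` of the centralizer of `a`: the conjugate commutes with `g * a ^ m *
g⁻¹`, a nonzero power of `a`, hence with `a`. -/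
theorem IsVirtualNormalizer.commute_conj (hH : IsVirtualNormalizer H a)
    (hct : IsCommutativeTransitive G) (htf : ∀ g : G, g ≠ 1 → ¬ IsOfFinOrder g) {g c : G}
    (hg : g ∈ H) (hc : Commute c a) : Commute (g * c * g⁻¹) a := by
  obtain ⟨m, n, -, hn, h⟩ := (hH g).1 hg
  refine hct.commute_of_commute_zpow htf hn ?_
  rw [← h]
  exact (hc.zpow_right m).conj g

theorem IsVirtualNormalizer.commute_conj' (hH : IsVirtualNormalizer H a)
    (hct : IsCommutativeTransitive G) (htf : ∀ g : G, g ≠ 1 → ¬ IsOfFinOrder g) {g c : G}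
    (hg : g ∈ H) (hc : Commute c a) : Commute (g⁻¹ * c * g) a := by
  simpa using hH.commute_conj hct htf (H.inv_mem hg) hc

theorem IsVirtualNormalizer.smul_mem (hH : IsVirtualNormalizer H a) {g : G} (hg : g ∈ H)
    {x : T.V} (hx : x ∈ T.virtualFix a) : g • x ∈ T.virtualFix a := by
  obtain ⟨m, n, hm, hn, h⟩ := (hH g).1 hg
  obtain ⟨k, hk, hkx⟩ := hx
  refine ⟨n * k, mul_ne_zero hn hk, ?_⟩
  rw [zpow_mul, ← h, conj_zpow, ← zpow_mul, mul_smul, inv_smul_smul, mul_smul, mul_comm, zpow_mul,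
    zpow_smul_eq hkx]

/-- The pointwise stabilizer of `g • u` and `g • v` is cyclic and contains non-trivial powers of
both `a` and `g * a * g⁻¹`, so these are commensurable. -/
theorem IsVirtualNormalizer.mem_of_smul_mem (hH : IsVirtualNormalizer H a)
    (htf : ∀ g : G, g ≠ 1 → ¬ IsOfFinOrder g) (ha : a ≠ 1) (hT : T.IsCyclicTree) {g : G}
    {u v : T.V} (huv : u ≠ v) (hu : u ∈ T.virtualFix a) (hv : v ∈ T.virtualFix a)
    (hgu : g • u ∈ T.virtualFix a) (hgv : g • v ∈ T.virtualFix a) : g ∈ H := by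
  obtain ⟨k, hk, hku, hkv⟩ := exists_common_zpow_fixing hu hv
  obtain ⟨l, hl, hlu, hlv⟩ := exists_common_zpow_fixing hgu hgv
  let K : Subgroup G := MulAction.stabilizer G (g • u) ⊓ MulAction.stabilizer G (g • v)
  have hK : IsCyclic K := isCyclic_of_fixes hT (fun he => huv (MulAction.injective g he))
    (fun x hx => hx.1) (fun x hx => hx.2)
  have h1 : g * a ^ k * g⁻¹ ∈ K := by
    constructor
    · change (g * a ^ k * g⁻¹) • g • u = g • u
      rw [mul_smul, inv_smul_smul, mul_smul, hku]
    · change (g * a ^ k * g⁻¹) • g • v = g • v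
      rw [mul_smul, inv_smul_smul, mul_smul, hkv]
  have h2 : a ^ l ∈ K := ⟨hlu, hlv⟩
  obtain ⟨m, n, hm, hn, h⟩ := exists_zpow_eq_zpow_of_isCyclic hK h1 h2
    (by
      rw [Ne, conj_eq_one_iff]
      exact zpow_ne_one_of_torsionFree htf ha hk)
    (zpow_ne_one_of_torsionFree htf ha hl)
  rw [conj_zpow, ← zpow_mul, ← zpow_mul] at h
  exact (hH g).2 ⟨_, _, mul_ne_zero hk hm, mul_ne_zero hl hn, h⟩

/-- Let `C` be the centralizer of `a`. If `G_x ∩ C` were cyclic, then `G_x ∩ H`, which normalizes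
it, would centralize it and so lie in `C`; hence `G_x ∩ C` is not cyclic. It cannot then fix two
vertices. As `C` is abelian, `G_x ∩ C` fixes every `c • x`, so `C` fixes `x`; as `C` is normal in
`H`, it then fixes every `g • x`, so `H` fixes `x`. -/
theorem smul_eq_of_not_isCyclic (htf : ∀ g : G, g ≠ 1 → ¬ IsOfFinOrder g)
    (hct : IsCommutativeTransitive G) (hH : IsVirtualNormalizer H a) (ha : a ≠ 1)
    (hT : T.IsCyclicTree) {x : T.V} (hx : x ∈ T.virtualFix a)
    (hnc : ¬ IsCyclic (MulAction.stabilizer G x ⊓ H : Subgroup G)) {g : G} (hg : g ∈ H) :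
    g • x = x := by
  let C := Subgroup.centralizer {a}
  have hC : ∀ c, c ∈ C ↔ Commute c a := fun c => Subgroup.mem_centralizer_singleton_iff.trans
    ⟨fun h => h, fun h => h⟩
  have hK : ¬ IsCyclic (MulAction.stabilizer G x ⊓ C : Subgroup G) := by
    intro hK
    obtain ⟨b, hb⟩ := exists_generator hK
    have hbK : b ∈ MulAction.stabilizer G x ⊓ C := by rw [hb]; exact Subgroup.mem_zpowers b
    have hb1 : b ≠ 1 := by
      rintro rfl
      obtain ⟨n, hn, hnx⟩ := hx
      have : a ^ n ∈ MulAction.stabilizer G x ⊓ C := ⟨hnx, (hC _).2 ((Commute.refl a).zpow_left n)⟩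
      rw [hb, Subgroup.zpowers_one_eq_bot, Subgroup.mem_bot] at this
      exact zpow_ne_one_of_torsionFree htf ha hn this
    have hle : MulAction.stabilizer G x ⊓ H ≤ MulAction.stabilizer G x ⊓ C := by
      intro h hh
      refine ⟨hh.1, (hC h).2 ?_⟩
      have hc : Commute h b := by
        refine hct.commute_of_normalizes htf ?_ ?_
        · rw [← hb]
          exact ⟨Subgroup.mul_mem _ (Subgroup.mul_mem _ hh.1 hbK.1) (Subgroup.inv_mem _ hh.1),
            (hC _).2 (hH.commute_conj hct htf hh.2 ((hC _).1 hbK.2))⟩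
        · rw [← hb]
          exact ⟨Subgroup.mul_mem _ (Subgroup.mul_mem _ (Subgroup.inv_mem _ hh.1) hbK.1) hh.1,
            (hC _).2 (hH.commute_conj' hct htf hh.2 ((hC _).1 hbK.2))⟩
      exact hct.commute_of_commute hb1 hc ((hC _).1 hbK.2).symm
    exact hnc (Subgroup.isCyclic_of_le hle)
  have hCx : ∀ c, Commute c a → c • x = x := by
    intro c hc
    by_contra hne
    refine hK (isCyclic_of_fixes hT hne (fun k hk => ?_) (fun k hk => hk.1))
    have h1 : k * c = c * k := (hct.commute_of_commute ha ((hC k).1 hk.2) hc).eq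
    rw [← mul_smul, h1, mul_smul, show k • x = x from hk.1]
  by_contra hne
  refine hK (isCyclic_of_fixes hT hne (fun k hk => ?_) (fun k hk => hk.1))
  have h1 := hCx _ (hH.commute_conj' hct htf hg ((hC k).1 hk.2))
  rwa [mul_smul, mul_smul, inv_smul_eq_iff] at h1

/-- If the vertices of `virtualFix a` have cyclic stabilizers in `H`, then the elements of `H` with a
fixed vertex commute with `a`. -/
theorem IsVirtualNormalizer.commute_of_fixed (hH : IsVirtualNormalizer H a)
    (htf : ∀ g : G, g ≠ 1 → ¬ IsOfFinOrder g) (hct : IsCommutativeTransitive G)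
    (hT : T.IsGTree) (hne : (T.virtualFix a).Nonempty)
    (hcyc : ∀ x ∈ T.virtualFix a, IsCyclic (MulAction.stabilizer G x ⊓ H : Subgroup G))
    {g : G} (hg : g ∈ H) {z : T.V} (hz : g • z = z) :
    Commute g a ∧ ∃ x ∈ T.virtualFix a, g • x = x := by
  obtain ⟨x, hx, hgx⟩ := exists_fixed_of_zpow hT (gconvex_virtualFix hT.1 a) hne
    (fun x hx => hH.smul_mem hg hx) one_ne_zero (by rwa [zpow_one])
  refine ⟨?_, x, hx, hgx⟩
  obtain ⟨n, hn, hnx⟩ := id hx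
  exact hct.commute_of_commute_zpow htf hn (commute_of_mem_of_isCyclic (hcyc x hx) ⟨hgx, hg⟩
    ⟨hnx, hH.mem_of_commute ((Commute.refl a).zpow_left n)⟩)

/-- The aim is to show that `H` centralizes `a`. Elements of the centralizer fixing any vertex fix
`y` on the axis of `h`, so the cyclic group `G_y ∩ H` is normalized, hence centralized, by `H`. All
of `H` then commutes with `h` and shifts a ray of its axis. -/
theorem isSolvableBS_of_hyperbolic (htf : ∀ g : G, g ≠ 1 → ¬ IsOfFinOrder g)
    (hct : IsCommutativeTransitive G) (hH : IsVirtualNormalizer H a) (ha : a ≠ 1)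
    (hT : T.IsCyclicTree) (hne : (T.virtualFix a).Nonempty)
    (hcyc : ∀ x ∈ T.virtualFix a, IsCyclic (MulAction.stabilizer G x ⊓ H : Subgroup G))
    {h : G} (hh : Commute h a) (hfix : ∀ x ∈ T.virtualFix a, h • x ≠ x) : IsSolvableBS H := by
  have hhH := hH.mem_of_commute hh
  obtain ⟨y, hy, hb⟩ := exists_axis hT.1 (gconvex_virtualFix hT.1.1 a) hne
    (fun x hx => hH.smul_mem hhH hx)
  obtain ⟨r, hr, hr1, hpow, hsh, hcent⟩ := exists_axis_ray hT.1.1 (hfix y hy) hb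
  have hpos : 0 < T.graph.dist y (h • y) := hT.1.1.dist_pos (hfix y hy).symm
  have hrV : ∀ n, r n ∈ T.virtualFix a := fun n => by
    obtain ⟨k, hk⟩ := hr1 n
    exact gconvex_virtualFix hT.1.1 a hy (hH.smul_mem (H.pow_mem hhH k) hy) hk
  -- With zero shift, `c` fixes the far vertices `h ^ N • y` of the ray; commuting with `h` brings
  -- this back to `y`.
  have hfixy : ∀ c, Commute c a → ∀ z : T.V, c • z = z → c • y = y := by
    intro c hc z hz
    have hch := hct.commute_of_commute ha hc hh
    obtain ⟨d, hd⟩ := hcent c hch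
    rw [hd.eq_zero_of_fixed hr hT.1.1 hz] at hd
    obtain ⟨N, hN⟩ := hd.eventually_fixed
    have h1 := hN (N * T.graph.dist y (h • y)) (Nat.le_mul_of_pos_right _ hpos)
    rw [hpow, ← mul_smul, (hch.pow_right N).eq, mul_smul] at h1
    exact MulAction.injective _ h1
  obtain ⟨b, hbgen⟩ := exists_generator (hcyc y hy)
  have hbK : b ∈ MulAction.stabilizer G y ⊓ H := by rw [hbgen]; exact Subgroup.mem_zpowers b
  have hba : Commute b a := (hH.commute_of_fixed htf hct hT.1 hne hcyc hbK.2 hbK.1).1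
  have hb1 : b ≠ 1 := by
    rintro rfl
    obtain ⟨n, hn, hny⟩ := hy
    have : a ^ n ∈ MulAction.stabilizer G y ⊓ H :=
      ⟨hny, hH.mem_of_commute ((Commute.refl a).zpow_left n)⟩
    rw [hbgen, Subgroup.zpowers_one_eq_bot, Subgroup.mem_bot] at this
    exact zpow_ne_one_of_torsionFree htf ha hn this
  have hconj : ∀ g ∈ H, g * b * g⁻¹ ∈ Subgroup.zpowers b := fun g hg => by
    have hc := hH.commute_conj hct htf hg hba
    rw [← hbgen]
    refine ⟨hfixy _ hc (g • y) ?_, hH.mem_of_commute hc⟩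
    rw [mul_smul, inv_smul_smul, mul_smul, show b • y = y from hbK.1]
  have hab : ∀ g ∈ H, Commute g a := fun g hg =>
    hct.commute_of_commute hb1 (hct.commute_of_normalizes htf (hconj g hg)
      (by simpa using hconj g⁻¹ (H.inv_mem hg))) hba.symm
  refine isSolvableBS_of_hasShift hr htf hT.1.1
    (fun g hg => hcent g (hct.commute_of_commute ha (hab g hg) hh))
    ⟨h, hhH, _, by omega, hsh⟩ (fun n => hcyc _ (hrV n)) fun n => ?_
  obtain ⟨k, hk, hkn⟩ := hrV n
  exact ⟨a ^ k, hH.mem_of_commute ((Commute.refl a).zpow_left k),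
    zpow_ne_one_of_torsionFree htf ha hk, hkn⟩

/-- The fixed sets in `virtualFix a` of the elements centralizing `a` form a directed family without
common point, so they converge to an end. `H` normalizes the centralizer, so it fixes this end. -/
theorem isSolvableBS_of_elliptic (hfg : Group.FG G) (htf : ∀ g : G, g ≠ 1 → ¬ IsOfFinOrder g)
    (hct : IsCommutativeTransitive G) (hH : IsVirtualNormalizer H a) (ha : a ≠ 1)
    (hT : T.IsCyclicTree) (hne : (T.virtualFix a).Nonempty)
    (hcyc : ∀ x ∈ T.virtualFix a, IsCyclic (MulAction.stabilizer G x ⊓ H : Subgroup G))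
    (hell : ∀ c, Commute c a → ∃ x ∈ T.virtualFix a, c • x = x)
    (hnf : ∀ x ∈ T.virtualFix a, ∃ c, Commute c a ∧ c • x ≠ x) : IsSolvableBS H := by
  obtain ⟨x, hx⟩ := hne
  let K : {c // Commute c a} → Set T.V := fun c => {v | c.1 • v = v} ∩ T.virtualFix a
  have hKconv : ∀ c, T.graph.GConvex (K c) := fun c =>
    (gconvex_fixed hT.1.1 c.1).inter (gconvex_virtualFix hT.1.1 a)
  have hKne : ∀ c, (K c).Nonempty := fun c => by
    obtain ⟨v, hv, hv'⟩ := hell c.1 c.2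
    exact ⟨v, hv', hv⟩
  -- Commuting elliptic elements `c`, `c'` have a common fixed vertex `v`; a generator of the cyclic
  -- group `G_v ∩ H` fixes no more than either of them.
  have hdir : ∀ c c', ∃ c'', K c'' ⊆ K c ∩ K c' := by
    intro c c'
    have hcc := hct.commute_of_commute ha c.2 c'.2
    obtain ⟨w, -, hw⟩ := hell c'.1 c'.2
    obtain ⟨v, hv, hv'⟩ := exists_fixed_of_zpow hT.1 (hKconv c) (hKne c) (h := c'.1)
      (fun u hu => ⟨by
        change c.1 • c'.1 • u = c'.1 • u
        rw [← mul_smul, hcc.eq, mul_smul, show c.1 • u = u from hu.1],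
        hH.smul_mem (hH.mem_of_commute c'.2) hu.2⟩) one_ne_zero (z := w) (by rwa [zpow_one])
    obtain ⟨b, hb⟩ := exists_generator (hcyc v hv.2)
    have hbK : b ∈ MulAction.stabilizer G v ⊓ H := by rw [hb]; exact Subgroup.mem_zpowers b
    have hba := (hH.commute_of_fixed htf hct hT.1 ⟨x, hx⟩ hcyc hbK.2 hbK.1).1
    have hsub : ∀ d : {c // Commute c a}, d.1 • v = v → K ⟨b, hba⟩ ⊆ K d := by
      intro d hd u hu
      have hmem : d.1 ∈ MulAction.stabilizer G v ⊓ H := ⟨hd, hH.mem_of_commute d.2⟩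
      rw [hb] at hmem
      obtain ⟨n, hn⟩ := hmem
      simp only at hn
      exact ⟨by rw [Set.mem_ofPred_eq, ← hn]; exact zpow_smul_eq hu.1 n, hu.2⟩
    exact ⟨⟨b, hba⟩, Set.subset_inter (hsub c hv.1) (hsub c' hv')⟩
  choose p hp hgate using fun c => hT.1.1.exists_gate (hKconv c) (hKne c) x
  -- If the gates stayed bounded, a farthest one `p c` would be moved by some `d`, yet a smaller set
  -- in the family has the same gate and is fixed by `d`.
  have hunb : ∀ n, ∃ c, n ≤ T.graph.dist x (p c) := by
    by_contra! hcon
    obtain ⟨n, hn⟩ := hcon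
    obtain ⟨c, -, hmin⟩ := WellFounded.has_min (measure fun c => n - T.graph.dist x (p c)).wf
      Set.univ ⟨⟨a, Commute.refl a⟩, trivial⟩
    obtain ⟨d, hd, hdne⟩ := hnf (p c) (hp c).2
    obtain ⟨e, he⟩ := hdir c ⟨d, hd⟩
    have h1 := hgate c (p e) (he (hp e)).1
    have h2 : ¬ (n - T.graph.dist x (p e) < n - T.graph.dist x (p c)) := hmin e trivial
    have h3 := hn c
    have h4 := hn e
    have h5 : p c = p e := hT.1.1.eq_of_dist (by unfold SimpleGraph.Btw at h1; omega)
    rw [h5] at hdne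
    exact hdne (he (hp e)).2.1
  obtain ⟨r, hr0, hr, hr1, hr2⟩ := hT.1.1.exists_ray x p K hgate
    (fun c c' => by
      obtain ⟨e, he⟩ := hdir c c'
      exact ⟨p e, he (hp e)⟩) hunb
  have hrV : ∀ n, r n ∈ T.virtualFix a := fun n => by
    obtain ⟨c, hc⟩ := hr1 n
    exact gconvex_virtualFix hT.1.1 a hx (hp c).2 hc
  have hev : ∀ c, Commute c a → ∃ N, ∀ n, N ≤ n → c • r n = r n := fun c hc => by
    refine ⟨T.graph.dist x (p ⟨c, hc⟩), fun n hn => ?_⟩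
    obtain ⟨v, hv, hb⟩ := hr2 ⟨c, hc⟩ n hn
    exact smul_eq_of_btw hT.1.1 (hp ⟨c, hc⟩).1 hv.1 hb
  have hshift : ∀ g ∈ H, ∃ d, HasShift r g d := by
    intro g hg
    rcases hT.1.1.ray_dichotomy (r' := fun n => g • r n) hr
      (fun m n hmn => by rw [dist_smul hT.1.1]; exact hr m n hmn) with ⟨i, j, hij⟩ | ⟨N, M, hNM⟩
    · exact ⟨_, i, j, rfl, hij⟩
    · exfalso
      -- Both `c` and `g⁻¹ * c * g` fix a tail of `r`, so `c` fixes tails of `r` and of its image,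
      -- hence the vertex `r N` between them.
      obtain ⟨c, hc, hne⟩ := hnf (r N) (hrV N)
      obtain ⟨N₁, h1⟩ := hev c hc
      obtain ⟨N₂, h2⟩ := hev _ (hH.commute_conj' hct htf hg hc)
      refine hne (smul_eq_of_btw hT.1.1 (h1 (max N N₁) (le_max_right _ _)) ?_
        (hNM (max N N₁) (max M N₂) (le_max_left _ _) (le_max_left _ _)))
      have := h2 (max M N₂) (le_max_right _ _)
      rwa [mul_smul, mul_smul, inv_smul_eq_iff] at this
  have hnz : ∃ g ∈ H, ∃ d, d ≠ 0 ∧ HasShift r g d := by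
    by_contra! hcon
    -- Every edge of the ray lies on a segment from `x` to some `c • x`, so two of its edges are in
    -- one orbit. The element relating them lies in `H`, and zero shift would force it to preserve
    -- the distance to a far fixed vertex of the ray.
    obtain ⟨P, hP, hPorb⟩ := finite_orbits_of_fg hfg hT.1.1 x
    have horb : ∀ n, ∃ g : G, (g • r n, g • r (n + 1)) ∈ P := by
      intro n
      obtain ⟨c, hc⟩ := hr1 (n + 1)
      -- If the two geodesics from the gate to `x` and to `c • x` shared their first edge, `c` would
      -- fix that edge, contradicting that `p c` is the gate.
      have hpc : T.graph.Btw x (p c) (c.1 • x) := by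
        have hcp : c.1 • p c = p c := (hp c).1
        rcases hT.1.1.btw_or_exists_adj_closer x (p c) (c.1 • x) with h | ⟨m, hm, h1, h2⟩
        · exact h
        exfalso
        have h3 : T.graph.Adj (p c) (c.1 • m) := by
          have := T.smul_adj c.1 hm
          rwa [hcp] at this
        have h4 : T.graph.dist (c.1 • x) (p c) = T.graph.dist (c.1 • x) (c.1 • m) + 1 := by
          have h5 := dist_smul hT.1.1 c.1 x (p c)
          rw [hcp] at h5
          rw [h5, dist_smul hT.1.1, h1]
        have h5 := hT.1.1.adj_closer_unique h3 hm h4 h2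
        have h6 : T.graph.Btw x m (p c) := by
          have : T.graph.dist m (p c) = 1 := dist_eq_one_iff_adj.2 hm.symm
          unfold SimpleGraph.Btw
          omega
        have h7 := hgate c m ⟨h5, gconvex_virtualFix hT.1.1 a hx (hp c).2 h6⟩
        unfold SimpleGraph.Btw at h7
        omega
      have h1 := (hT.1.1.btw_trans hc hpc).1
      have h2 : T.graph.Btw x (r n) (r (n + 1)) := by
        rw [← hr0]
        exact ray_btw hr (Nat.zero_le n) (Nat.le_succ n)
      refine hPorb c.1 _ _ ?_ (hT.1.1.btw_trans h2 h1).1 h1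
      rw [← dist_eq_one_iff_adj, hr _ _ (Nat.le_succ n)]
      omega
    choose γ hγ using horb
    have := hP.to_subtype
    obtain ⟨i, j, hij, he⟩ := Finite.exists_ne_map_eq_of_infinite
      (fun n => (⟨(γ n • r n, γ n • r (n + 1)), hγ n⟩ : P))
    rw [Subtype.mk.injEq, Prod.mk.injEq] at he
    obtain ⟨e1, e2⟩ := he
    rw [← inv_smul_eq_iff, ← mul_smul] at e1 e2
    have hgH : (γ j)⁻¹ * γ i ∈ H := by
      refine hH.mem_of_smul_mem htf ha hT (u := r i) (v := r (i + 1)) ?_ (hrV _) (hrV _)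
        (by rw [e1]; exact hrV _) (by rw [e2]; exact hrV _)
      intro h
      have := ray_injective hr h
      omega
    obtain ⟨d, hd⟩ := hshift _ hgH
    obtain rfl : d = 0 := by
      by_contra hne
      exact hcon _ hgH d hne hd
    obtain ⟨N, hN⟩ := hd.eventually_fixed
    have h1 := dist_smul hT.1.1 ((γ j)⁻¹ * γ i) (r i) (r (N + i + j))
    rw [e1, hN _ (by omega), hr _ _ (by omega), hr _ _ (by omega)] at h1
    omega
  refine isSolvableBS_of_hasShift hr htf hT.1.1 hshift hnz (fun n => hcyc _ (hrV n)) fun n => ?_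
  obtain ⟨k, hk, hkn⟩ := hrV n
  exact ⟨a ^ k, hH.mem_of_commute ((Commute.refl a).zpow_left k),
    zpow_ne_one_of_torsionFree htf ha hk, hkn⟩

/-- The main dichotomy for stabilizers of cylinders. -/
theorem exists_fixed_or_isSolvableBS (hfg : Group.FG G)
    (htf : ∀ g : G, g ≠ 1 → ¬ IsOfFinOrder g)
    (hct : IsCommutativeTransitive G) (hH : IsVirtualNormalizer H a) (ha : a ≠ 1)
    (hT : T.IsCyclicTree) (hne : (T.virtualFix a).Nonempty) :
    (∃ x ∈ T.virtualFix a, ∀ g ∈ H, g • x = x) ∨ IsSolvableBS H := by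
  by_cases hcyc : ∀ x ∈ T.virtualFix a, IsCyclic (MulAction.stabilizer G x ⊓ H : Subgroup G)
  swap
  · push Not at hcyc
    obtain ⟨x, hx, hnc⟩ := hcyc
    exact Or.inl ⟨x, hx, fun g hg => smul_eq_of_not_isCyclic htf hct hH ha hT hx hnc hg⟩
  by_cases hell : ∀ c, Commute c a → ∃ x ∈ T.virtualFix a, c • x = x
  swap
  · push Not at hell
    obtain ⟨h, hh, hfix⟩ := hell
    exact Or.inr (isSolvableBS_of_hyperbolic htf hct hH ha hT hne hcyc hh hfix)
  by_cases hnf : ∀ x ∈ T.virtualFix a, ∃ c, Commute c a ∧ c • x ≠ x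
  · exact Or.inr (isSolvableBS_of_elliptic hfg htf hct hH ha hT hne hcyc hell hnf)
  push Not at hnf
  obtain ⟨x, hx, hCx⟩ := hnf
  -- Here the centralizer of `a` is the cyclic group `G_x ∩ H`; `H` normalizes it, so `H`
  -- centralizes it and therefore commutes with `a`.
  refine Or.inl ⟨x, hx, fun g hg => hCx g ?_⟩
  obtain ⟨b, hb⟩ := exists_generator (hcyc x hx)
  have hmem : ∀ c, Commute c a → c ∈ Subgroup.zpowers b := fun c hc => by
    rw [← hb]; exact ⟨hCx c hc, hH.mem_of_commute hc⟩
  have hb1 : b ≠ 1 := by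
    rintro rfl
    have := hmem a (Commute.refl a)
    rw [Subgroup.zpowers_one_eq_bot, Subgroup.mem_bot] at this
    exact ha this
  have hbK : b ∈ MulAction.stabilizer G x ⊓ H := by rw [hb]; exact Subgroup.mem_zpowers b
  have hba : Commute b a := (hH.commute_of_fixed htf hct hT.1 hne hcyc hbK.2 hbK.1).1
  exact hct.commute_of_commute hb1 (hct.commute_of_normalizes htf
    (hmem _ (hH.commute_conj hct htf hg hba)) (hmem _ (hH.commute_conj' hct htf hg hba))) hba.symm

end VirtualNormalizer

end ActionGraph

/-! ### Commensurability of cyclic subgroups. -/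

section Commensurable

variable {G : Type u} [Group G]

/-- The powers `a ^ i` with `0 ≤ i < |m|` represent all cosets. -/
theorem relIndex_zpowers_ne_zero {a b : G} {m n : ℤ} (hm : m ≠ 0) (h : a ^ m = b ^ n) :
    (Subgroup.zpowers b).relIndex (Subgroup.zpowers a) ≠ 0 := by
  let f : Set.Ico (0 : ℤ) |m| → Subgroup.zpowers a ⧸ (Subgroup.zpowers b).subgroupOf
    (Subgroup.zpowers a) := fun i => QuotientGroup.mk ⟨a ^ i.1, Subgroup.zpow_mem_zpowers a _⟩
  have hf : Function.Surjective f := by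
    intro x
    induction x using QuotientGroup.induction_on with
    | H x =>
      obtain ⟨_, k, rfl⟩ := x
      refine ⟨⟨k % m, Int.emod_nonneg _ hm, Int.emod_lt_abs _ hm⟩, ?_⟩
      rw [QuotientGroup.eq, Subgroup.mem_subgroupOf]
      refine ⟨n * (k / m), ?_⟩
      simp only [Subgroup.coe_mul, InvMemClass.coe_inv]
      rw [zpow_mul, ← h, ← zpow_mul, ← zpow_neg, ← zpow_add]
      congr 1
      linarith [Int.emod_add_mul_ediv k m]
  have := Finite.of_surjective f hf
  exact Subgroup.index_ne_zero_of_finite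

theorem commensurable_zpowers_iff (htf : ∀ g : G, g ≠ 1 → ¬ IsOfFinOrder g) {a b : G}
    (ha : a ≠ 1) :
    Subgroup.Commensurable (Subgroup.zpowers a) (Subgroup.zpowers b) ↔
      ∃ m n : ℤ, m ≠ 0 ∧ n ≠ 0 ∧ a ^ m = b ^ n := by
  constructor
  · rintro ⟨-, h⟩
    obtain ⟨n, hn, -, hn'⟩ := Subgroup.exists_pow_mem_of_relIndex_ne_zero h
      (Subgroup.mem_zpowers a)
    obtain ⟨k, hk⟩ := (Subgroup.mem_inf.1 hn').1
    simp only at hk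
    refine ⟨n, k, by omega, ?_, by rw [hk, zpow_natCast]⟩
    rintro rfl
    refine zpow_ne_one_of_torsionFree htf ha (n := n) (by omega) ?_
    rw [zpow_natCast, ← hk, zpow_zero]
  · rintro ⟨m, n, hm, hn, h⟩
    exact ⟨relIndex_zpowers_ne_zero hn h.symm, relIndex_zpowers_ne_zero hm h⟩

end Commensurable

/-! ### Acyclicity expressed by separating sets of vertices. -/

namespace SimpleGraph

variable {V : Type*} {Γ : SimpleGraph V}

/-- Such a set `A` shows that the edge is a bridge. Separating sets, unlike cycles, transfer easily
to the tree of cylinders and to quotients. -/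
theorem isAcyclic_of_separating (h : ∀ u v, Γ.Adj u v → ∃ A : V → Prop, A u ∧ ¬ A v ∧
    ∀ x y, Γ.Adj x y → s(x, y) ≠ s(u, v) → A x → A y) : Γ.IsAcyclic := by
  rw [isAcyclic_iff_forall_adj_isBridge]
  intro u v huv
  rw [isBridge_iff]
  rintro ⟨p⟩
  obtain ⟨A, hu, hv, hA⟩ := h u v huv
  have key : ∀ {x y : V}, (Γ.deleteEdges {s(u, v)}).Walk x y → A x → A y := by
    intro x y q
    induction q with
    | nil => exact id
    | cons hadj q ih =>
      rw [deleteEdges_adj] at hadj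
      exact fun hx => ih (hA _ _ hadj.1 hadj.2 hx)
  exact hv (key p hu)

theorem IsAcyclic.exists_separating (hΓ : Γ.IsAcyclic) {u v : V} (h : Γ.Adj u v) :
    ∃ A : V → Prop, A u ∧ ¬ A v ∧ ∀ x y, Γ.Adj x y → s(x, y) ≠ s(u, v) → A x → A y := by
  rw [isAcyclic_iff_forall_adj_isBridge] at hΓ
  have := hΓ h
  rw [isBridge_iff] at this
  refine ⟨fun z => (Γ.deleteEdges {s(u, v)}).Reachable u z, Reachable.refl u, this, ?_⟩
  intro x y hxy hne hx
  exact hx.trans (Adj.reachable (by simp [deleteEdges_adj, hxy, hne]))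

end SimpleGraph

/-! ### Cylinders and their stabilizers. -/

namespace ActionGraph

open SimpleGraph

variable {G : Type u} [Group G] {T : ActionGraph.{u, v} G}

/-- The element `a` generates the stabilizer of an edge of the cylinder `Y`. -/
def GeneratesEdgeStab (T : ActionGraph.{u, v} G) (Y : T.Cylinder) (a : G) : Prop :=
  ∃ e : T.graph.edgeSet, Quotient.mk T.cylinderSetoid e = Y ∧ T.edgeStab e.1 = Subgroup.zpowers a

theorem mem_edgeStab {g : G} {x y : T.V} : g ∈ T.edgeStab s(x, y) ↔ g • x = x ∧ g • y = y := by
  simp [edgeStab, mem_fixingSubgroup_iff]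

theorem exists_edge_generator (hT : T.IsCyclicTree) (e : T.graph.edgeSet) :
    ∃ a, a ≠ 1 ∧ T.edgeStab e.1 = Subgroup.zpowers a := by
  obtain ⟨h1, h2⟩ := hT.2 e.1 e.2
  obtain ⟨a, ha⟩ := exists_generator h1
  refine ⟨a, ?_, ha⟩
  rintro rfl
  rw [ha, Subgroup.zpowers_one_eq_bot] at h2
  exact not_finite (⊥ : Subgroup G)

theorem exists_generatesEdgeStab (hT : T.IsCyclicTree) (Y : T.Cylinder) :
    ∃ a, a ≠ 1 ∧ T.GeneratesEdgeStab Y a := by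
  induction Y using Quotient.ind with
  | _ e =>
    obtain ⟨a, ha, h⟩ := exists_edge_generator hT e
    exact ⟨a, ha, e, rfl, h⟩

theorem generates_eq_iff (htf : ∀ g : G, g ≠ 1 → ¬ IsOfFinOrder g) {Y Y' : T.Cylinder}
    {a b : G} (ha : a ≠ 1) (h : T.GeneratesEdgeStab Y a) (h' : T.GeneratesEdgeStab Y' b) :
    Y = Y' ↔ ∃ m n : ℤ, m ≠ 0 ∧ n ≠ 0 ∧ a ^ m = b ^ n := by
  obtain ⟨e, rfl, he⟩ := h
  obtain ⟨e', rfl, he'⟩ := h'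
  rw [← commensurable_zpowers_iff htf ha, ← he, ← he']
  exact Quotient.eq

theorem GeneratesEdgeStab.smul {Y : T.Cylinder} {a : G} (h : T.GeneratesEdgeStab Y a) (g : G) :
    T.GeneratesEdgeStab (g • Y) (g * a * g⁻¹) := by
  obtain ⟨e, rfl, he⟩ := h
  refine ⟨g • e, rfl, ?_⟩
  rw [edge_smul_val, edgeStab_map, he]
  ext x
  rw [Subgroup.mem_pointwise_smul_iff_inv_smul_mem, ← ConjAct.toConjAct_inv,
    ConjAct.toConjAct_smul, Subgroup.mem_zpowers_iff, Subgroup.mem_zpowers_iff]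
  refine exists_congr fun k => ?_
  rw [conj_zpow, inv_inv]
  constructor
  · intro h; rw [h]; group
  · intro h; rw [← h]; group

theorem isVirtualNormalizer_stabilizer (htf : ∀ g : G, g ≠ 1 → ¬ IsOfFinOrder g)
    {Y : T.Cylinder} {a : G} (ha : a ≠ 1) (h : T.GeneratesEdgeStab Y a) :
    IsVirtualNormalizer (MulAction.stabilizer G Y) a := by
  intro g
  rw [MulAction.mem_stabilizer_iff, generates_eq_iff htf (by rwa [Ne, conj_eq_one_iff]) (h.smul g) h]
  simp only [conj_zpow]

theorem generatesEdgeStab_of_adj (hT : T.IsCyclicTree)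
    (htf : ∀ g : G, g ≠ 1 → ¬ IsOfFinOrder g) {Y : T.Cylinder} {a : G} (ha : a ≠ 1)
    (h : T.GeneratesEdgeStab Y a) {x y : T.V} (hxy : T.graph.Adj x y) (hx : x ∈ T.virtualFix a)
    (hy : y ∈ T.virtualFix a) : Quotient.mk T.cylinderSetoid ⟨s(x, y), hxy⟩ = Y := by
  obtain ⟨b, hb, hb'⟩ := exists_edge_generator hT ⟨s(x, y), hxy⟩
  obtain ⟨n, hn, hnx, hny⟩ := exists_common_zpow_fixing hx hy
  refine (generates_eq_iff htf hb ⟨_, rfl, hb'⟩ h).2 ?_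
  have : a ^ n ∈ Subgroup.zpowers b := by
    rw [← hb']
    exact mem_edgeStab.2 ⟨hnx, hny⟩
  obtain ⟨m, hm⟩ := this
  simp only at hm
  refine ⟨m, n, ?_, hn, hm⟩
  rintro rfl
  exact zpow_ne_one_of_torsionFree htf ha hn (by simpa using hm.symm)

/-- For the converse, join `x` to an end of an edge stabilized by `⟨a⟩`. The geodesic stays in the
convex set `virtualFix a`, so its last edge belongs to `Y`. -/
theorem memCylinder_iff (hT : T.IsCyclicTree) (htf : ∀ g : G, g ≠ 1 → ¬ IsOfFinOrder g)
    {Y : T.Cylinder} {a : G} (ha : a ≠ 1) (h : T.GeneratesEdgeStab Y a) {x : T.V} :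
    T.MemCylinder x Y ↔ x ∈ T.virtualFix a := by
  constructor
  · rintro ⟨e, rfl, hx⟩
    obtain ⟨b, hb, hb'⟩ := exists_edge_generator hT e
    obtain ⟨m, n, hm, hn, hmn⟩ := (generates_eq_iff htf ha h ⟨e, rfl, hb'⟩).1 rfl
    refine ⟨m, hm, ?_⟩
    have : a ^ m ∈ T.edgeStab e.1 := by
      rw [hb', hmn]
      exact Subgroup.zpow_mem_zpowers b n
    rw [edgeStab, mem_fixingSubgroup_iff] at this
    exact this x hx
  · intro hx
    obtain ⟨⟨e, hemem⟩, he, he'⟩ := id h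
    induction e with
    | h u v =>
      have hu : u ∈ T.virtualFix a := by
        have : a ∈ T.edgeStab s(u, v) := by rw [he']; exact Subgroup.mem_zpowers a
        exact ⟨1, one_ne_zero, by simpa using (mem_edgeStab.1 this).1⟩
      by_cases hux : u = x
      · subst hux
        exact ⟨_, he, Sym2.mem_mk_left _ _⟩
      · obtain ⟨n, hn, hd⟩ := hT.1.1.exists_adj_closer hux
        have hb : T.graph.Btw u n x := by
          have : T.graph.dist n x = 1 := dist_eq_one_iff_adj.2 hn.symm
          unfold SimpleGraph.Btw
          omega
        exact ⟨_, generatesEdgeStab_of_adj hT htf ha h hn hx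
          (gconvex_virtualFix hT.1.1 a hu hx hb), Sym2.mem_mk_left _ _⟩

theorem gconvex_cylinder (hT : T.IsCyclicTree) (htf : ∀ g : G, g ≠ 1 → ¬ IsOfFinOrder g)
    (Y : T.Cylinder) : T.graph.GConvex {x | T.MemCylinder x Y} := by
  obtain ⟨a, ha, h⟩ := exists_generatesEdgeStab hT Y
  have := gconvex_virtualFix hT.1.1 a
  convert this using 1
  ext x
  exact memCylinder_iff hT htf ha h

/-- The cyclic group fixing both vertices contains non-trivial powers of edge generators of both
cylinders. -/
theorem cylinder_eq_of_mem (hT : T.IsCyclicTree) (htf : ∀ g : G, g ≠ 1 → ¬ IsOfFinOrder g)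
    {Y Y' : T.Cylinder} {u v : T.V} (huv : u ≠ v) (hu : T.MemCylinder u Y)
    (hv : T.MemCylinder v Y) (hu' : T.MemCylinder u Y') (hv' : T.MemCylinder v Y') : Y = Y' := by
  obtain ⟨a, ha, h⟩ := exists_generatesEdgeStab hT Y
  obtain ⟨b, hb, h'⟩ := exists_generatesEdgeStab hT Y'
  rw [memCylinder_iff hT htf ha h] at hu hv
  rw [memCylinder_iff hT htf hb h'] at hu' hv'
  obtain ⟨k, hk, hku, hkv⟩ := exists_common_zpow_fixing hu hv
  obtain ⟨l, hl, hlu, hlv⟩ := exists_common_zpow_fixing hu' hv'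
  let K : Subgroup G := MulAction.stabilizer G u ⊓ MulAction.stabilizer G v
  have hK : IsCyclic K := isCyclic_of_fixes hT huv (fun x hx => hx.1) (fun x hx => hx.2)
  obtain ⟨m, n, hm, hn, hmn⟩ := exists_zpow_eq_zpow_of_isCyclic hK (x := a ^ k) (y := b ^ l)
    ⟨hku, hkv⟩ ⟨hlu, hlv⟩ (zpow_ne_one_of_torsionFree htf ha hk)
    (zpow_ne_one_of_torsionFree htf hb hl)
  rw [← zpow_mul, ← zpow_mul] at hmn
  exact (generates_eq_iff htf ha h h').2 ⟨_, _, mul_ne_zero hk hm, mul_ne_zero hl hn, hmn⟩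

theorem exists_mem_cylinder_ne (Y : T.Cylinder) (x : T.V) : ∃ v, v ≠ x ∧ T.MemCylinder v Y := by
  induction Y using Quotient.ind with
  | _ e =>
    obtain ⟨e, he⟩ := e
    induction e with
    | h u v =>
      by_cases hu : u = x
      · exact ⟨v, fun hv => (T.graph.ne_of_adj he) (hu.trans hv.symm), _, rfl,
          Sym2.mem_mk_right _ _⟩
      · exact ⟨u, hu, _, rfl, Sym2.mem_mk_left _ _⟩

theorem exists_cylinder_of_mem (hT : T.IsGTree) (hne : Nontrivial T.V) (x : T.V) :
    ∃ Y, T.MemCylinder x Y := by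
  obtain ⟨y, hy⟩ := exists_ne x
  obtain ⟨n, hn, -⟩ := hT.1.exists_adj_closer hy
  exact ⟨_, ⟨s(x, n), hn⟩, rfl, Sym2.mem_mk_left _ _⟩

/-! ### The tree of cylinders is a tree -/

theorem reachable_cylinders_of_mem {x : T.V} {Y Y' : T.Cylinder} (h : T.MemCylinder x Y)
    (h' : T.MemCylinder x Y') :
    T.treeOfCylinders.graph.Reachable (Sum.inr Y : T.treeOfCylinders.V)
      (Sum.inr Y' : T.treeOfCylinders.V) := by
  by_cases hY : Y = Y'
  · rw [hY]
    exact Reachable.refl _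
  · let z : T.BoundaryVertex := ⟨x, Y, Y', hY, h, h'⟩
    have h1 : T.treeOfCylinders.graph.Adj (Sum.inr Y : T.treeOfCylinders.V)
      (Sum.inl z : T.treeOfCylinders.V) := ⟨z, Y, h, Or.inr ⟨rfl, rfl⟩⟩
    have h2 : T.treeOfCylinders.graph.Adj (Sum.inl z : T.treeOfCylinders.V)
      (Sum.inr Y' : T.treeOfCylinders.V) := ⟨z, Y', h', Or.inl ⟨rfl, rfl⟩⟩
    exact h1.reachable.trans h2.reachable

theorem connected_treeOfCylinders (hT : T.IsGTree) (hne : Nontrivial T.V) :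
    T.treeOfCylinders.graph.Connected := by
  have key : ∀ {x y : T.V} (_ : T.graph.Walk x y) (Y Y' : T.Cylinder), T.MemCylinder x Y →
      T.MemCylinder y Y' → T.treeOfCylinders.graph.Reachable (Sum.inr Y : T.treeOfCylinders.V)
      (Sum.inr Y' : T.treeOfCylinders.V) := by
    intro x y p
    induction p with
    | nil => exact fun Y Y' h h' => reachable_cylinders_of_mem h h'
    | cons hadj p ih =>
      rename_i x z y
      intro Y Y' h h'
      let e : T.graph.edgeSet := ⟨s(x, z), hadj⟩
      exact (reachable_cylinders_of_mem h ⟨e, rfl, Sym2.mem_mk_left _ _⟩).trans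
        (ih _ Y' ⟨e, rfl, Sym2.mem_mk_right _ _⟩ h')
  have hcyl : ∀ Y Y' : T.Cylinder, T.treeOfCylinders.graph.Reachable
      (Sum.inr Y : T.treeOfCylinders.V) (Sum.inr Y' : T.treeOfCylinders.V) := by
    intro Y Y'
    obtain ⟨x⟩ := hT.1.1.nonempty
    obtain ⟨v, -, hv⟩ := exists_mem_cylinder_ne Y x
    obtain ⟨v', -, hv'⟩ := exists_mem_cylinder_ne Y' x
    obtain ⟨p⟩ := hT.1.1.preconnected v v'
    exact key p Y Y' hv hv'
  have hvert : ∀ a : T.treeOfCylinders.V, ∃ Y : T.Cylinder,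
      T.treeOfCylinders.graph.Reachable a (Sum.inr Y : T.treeOfCylinders.V) := by
    rintro (x | Y)
    · obtain ⟨Y, -, -, h, -⟩ := x.2
      exact ⟨Y, Adj.reachable ⟨x, Y, h, Or.inl ⟨rfl, rfl⟩⟩⟩
    · exact ⟨Y, Reachable.refl _⟩
  obtain ⟨x⟩ := hT.1.1.nonempty
  obtain ⟨Y, -⟩ := exists_cylinder_of_mem hT hne x
  have : Nonempty T.treeOfCylinders.V := ⟨(Sum.inr Y : T.treeOfCylinders.V)⟩
  refine ⟨fun a b => ?_⟩
  obtain ⟨Y, hY⟩ := hvert a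
  obtain ⟨Y', hY'⟩ := hvert b
  exact hY.trans ((hcyl Y Y').trans hY'.symm)

/-- The vertices separated from `x` by an edge of the cylinder `Y` containing `x`. -/
def Beyond (T : ActionGraph.{u, v} G) (x : T.V) (Y : T.Cylinder) (v : T.V) : Prop :=
  ∃ z, z ≠ x ∧ T.MemCylinder z Y ∧ T.graph.Btw x z v

theorem not_beyond_self (hT : T.IsGTree) {x : T.V} {Y : T.Cylinder} : ¬ T.Beyond x Y x := by
  rintro ⟨z, hz, -, hb⟩
  refine hz (hT.1.eq_of_dist ?_).symm
  unfold SimpleGraph.Btw at hb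
  rw [dist_self] at hb
  omega

/-- The median of `x`, `v`, `v'` lies in `Y'` by convexity. If it is not `x`, the geodesics to `v`
and `v'` leave `x` by the same edge; if it is `x`, then `Y` and `Y'` share two vertices and
coincide. -/
theorem Beyond.transfer (hT : T.IsCyclicTree) (htf : ∀ g : G, g ≠ 1 → ¬ IsOfFinOrder g)
    {x v v' : T.V} {Y Y' : T.Cylinder} (hx : T.MemCylinder x Y) (hv : T.MemCylinder v Y')
    (hv' : T.MemCylinder v' Y') (hne : v' ≠ x) (h : T.Beyond x Y v) : T.Beyond x Y v' := by
  obtain ⟨z, hz, hzY, hb⟩ := h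
  obtain ⟨m, h1, h2, h3⟩ := hT.1.1.exists_median x v v'
  have hm : T.MemCylinder m Y' := gconvex_cylinder hT htf Y' hv hv' h2
  by_cases hmx : m = x
  · have hxY' : T.MemCylinder x Y' := hmx ▸ hm
    have hzY' := gconvex_cylinder hT htf Y' hxY' hv hb
    have := cylinder_eq_of_mem hT htf hz.symm hx hzY hxY' hzY'
    subst this
    exact ⟨v', hne, hv', btw_right _ _⟩
  · rcases le_total (T.graph.dist x z) (T.graph.dist x m) with hle | hle
    · exact ⟨z, hz, hzY, (hT.1.1.btw_trans (hT.1.1.btw_of_le h1 hb hle).1 h3).1⟩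
    · exact ⟨m, hmx, gconvex_cylinder hT htf Y hx hzY (hT.1.1.btw_of_le hb h1 hle).1, h3⟩

theorem exists_separating_treeOfCylinders (htf : ∀ g : G, g ≠ 1 → ¬ IsOfFinOrder g)
    (hT : T.IsCyclicTree) {x : T.BoundaryVertex} {Y : T.Cylinder} (hx : T.MemCylinder x.1 Y) :
    ∃ A : T.treeOfCylinders.V → Prop, A (Sum.inr Y : T.treeOfCylinders.V) ∧
      ¬ A (Sum.inl x : T.treeOfCylinders.V) ∧
      ∀ (x' : T.BoundaryVertex) (Y' : T.Cylinder), T.MemCylinder x'.1 Y' →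
        ¬ (x' = x ∧ Y' = Y) → (A (Sum.inl x' : T.treeOfCylinders.V) ↔
          A (Sum.inr Y' : T.treeOfCylinders.V)) := by
  refine ⟨Sum.elim (fun x' => T.Beyond x.1 Y x'.1)
    (fun Y' => ∃ v, v ≠ x.1 ∧ T.MemCylinder v Y' ∧ T.Beyond x.1 Y v), ?_, not_beyond_self hT.1, ?_⟩
  · obtain ⟨v, hv, hvY⟩ := exists_mem_cylinder_ne Y x.1
    exact ⟨v, hv, hvY, v, hv, hvY, btw_right _ _⟩
  · intro x' Y' hx' hne
    constructor
    · intro h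
      refine ⟨x'.1, ?_, hx', h⟩
      intro he
      have h' : T.Beyond x.1 Y x'.1 := h
      rw [he] at h'
      exact not_beyond_self hT.1 h'
    · rintro ⟨v, hv, hvY', h⟩
      refine h.transfer hT htf hx hvY' hx' fun he => hne ⟨Subtype.ext he, ?_⟩
      obtain ⟨z, hz, hzY, hb⟩ := h
      rw [he] at hx'
      exact cylinder_eq_of_mem hT htf hz.symm hx' (gconvex_cylinder hT htf Y' hx' hvY' hb) hx hzY

theorem isGTree_treeOfCylinders (htf : ∀ g : G, g ≠ 1 → ¬ IsOfFinOrder g) (hT : T.IsCyclicTree)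
    (hne : Nontrivial T.V) : T.treeOfCylinders.IsGTree := by
  refine ⟨⟨connected_treeOfCylinders hT.1 hne, ?_⟩, ?_⟩
  · refine isAcyclic_of_separating ?_
    rintro _ _ ⟨x, Y, hx, huv⟩
    obtain ⟨A, h1, h2, hA⟩ := exists_separating_treeOfCylinders htf hT hx
    rcases huv with ⟨rfl, rfl⟩ | ⟨rfl, rfl⟩
    · refine ⟨fun z => ¬ A z, h2, not_not.2 h1, ?_⟩
      rintro _ _ ⟨x', Y', hx', ⟨rfl, rfl⟩ | ⟨rfl, rfl⟩⟩ hne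
      · exact mt (hA x' Y' hx' (by rintro ⟨rfl, rfl⟩; exact hne rfl)).2
      · exact mt (hA x' Y' hx' (by rintro ⟨rfl, rfl⟩; exact hne Sym2.eq_swap)).1
    · refine ⟨A, h1, h2, ?_⟩
      rintro _ _ ⟨x', Y', hx', ⟨rfl, rfl⟩ | ⟨rfl, rfl⟩⟩ hne
      · exact (hA x' Y' hx' (by rintro ⟨rfl, rfl⟩; exact hne Sym2.eq_swap)).1
      · exact (hA x' Y' hx' (by rintro ⟨rfl, rfl⟩; exact hne rfl)).2
  · rintro g a b ⟨x, Y, -, ⟨rfl, rfl⟩ | ⟨rfl, rfl⟩⟩ ⟨h, -⟩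
    · exact absurd h (by rintro ⟨⟩)
    · exact absurd h (by rintro ⟨⟩)

end ActionGraph

namespace ActionGraph

open SimpleGraph

variable {G : Type u} [Group G] {T : ActionGraph.{u, v} G}

/-! ### Collapsing the edges of a tree -/

theorem isInfiniteCyclic_of_mk_ne {x y : T.V} (h : T.graph.Adj x y)
    (hne : T.collapsedEdges.connectedComponentMk x ≠ T.collapsedEdges.connectedComponentMk y) :
    IsInfiniteCyclic (T.edgeStab s(x, y)) := by
  by_contra hc
  have hadj : T.collapsedEdges.Adj x y := ⟨h, hc⟩
  exact hne (ConnectedComponent.eq.2 hadj.reachable)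

/-- A separating set for an edge between two components descends to the components. -/
theorem exists_separating_components (hT : T.graph.IsTree) {x y : T.V} (h : T.graph.Adj x y)
    (hne : T.collapsedEdges.connectedComponentMk x ≠ T.collapsedEdges.connectedComponentMk y) :
    ∃ A : T.collapsedEdges.ConnectedComponent → Prop,
      A (T.collapsedEdges.connectedComponentMk x) ∧
      ¬ A (T.collapsedEdges.connectedComponentMk y) ∧
      ∀ x' y', T.graph.Adj x' y' → s(x', y') ≠ s(x, y) →
        A (T.collapsedEdges.connectedComponentMk x') →
        A (T.collapsedEdges.connectedComponentMk y') := by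
  obtain ⟨A, hx, hy, hA⟩ := hT.2.exists_separating h
  have hwalk : ∀ {p q : T.V}, T.collapsedEdges.Walk p q → A p → A q := by
    intro p q w
    induction w with
    | nil => exact id
    | cons hadj w ih =>
      intro hp
      refine ih (hA _ _ hadj.1 (fun he => ?_) hp)
      have hr := ConnectedComponent.eq.2 hadj.reachable
      rcases Sym2.eq_iff.1 he with ⟨rfl, rfl⟩ | ⟨rfl, rfl⟩
      · exact hne hr
      · exact hne hr.symm
  have hcomp : ∀ p q, T.collapsedEdges.connectedComponentMk p =
      T.collapsedEdges.connectedComponentMk q → A p → A q := by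
    intro p q h
    obtain ⟨w⟩ := ConnectedComponent.eq.1 h
    exact hwalk w
  refine ⟨fun C => ∃ z, T.collapsedEdges.connectedComponentMk z = C ∧ A z, ⟨x, rfl, hx⟩, ?_, ?_⟩
  · rintro ⟨z, hz, hAz⟩
    exact hy (hcomp z y hz hAz)
  · rintro x' y' hxy' hne' ⟨z, hz, hAz⟩
    exact ⟨y', rfl, hA x' y' hxy' hne' (hcomp z x' hz hAz)⟩

/-- At most one edge joins two given components. -/
theorem eq_of_mk_eq (hT : T.graph.IsTree) {x y x' y' : T.V} (h : T.graph.Adj x y)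
    (h' : T.graph.Adj x' y')
    (hne : T.collapsedEdges.connectedComponentMk x ≠ T.collapsedEdges.connectedComponentMk y)
    (hx : T.collapsedEdges.connectedComponentMk x' = T.collapsedEdges.connectedComponentMk x)
    (hy : T.collapsedEdges.connectedComponentMk y' = T.collapsedEdges.connectedComponentMk y) :
    x' = x ∧ y' = y := by
  obtain ⟨A, h1, h2, hA⟩ := exists_separating_components hT h hne
  by_cases he : s(x', y') = s(x, y)
  · rcases Sym2.eq_iff.1 he with h3 | ⟨rfl, rfl⟩
    · exact h3
    · exact absurd hx.symm hne
  · have := hA x' y' h' he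
    rw [hx, hy] at this
    exact absurd (this h1) h2

theorem isCyclicTree_collapse (hT : T.IsGTree) : T.collapse.IsCyclicTree := by
  refine ⟨⟨⟨?_, ?_⟩, ?_⟩, ?_⟩
  · have hwalk : ∀ {p q : T.V}, T.graph.Walk p q → T.collapse.graph.Reachable
        (T.collapsedEdges.connectedComponentMk p) (T.collapsedEdges.connectedComponentMk q) := by
      intro p q w
      induction w with
      | nil => exact Reachable.refl _
      | cons hadj w ih =>
        rename_i a b c
        by_cases he : T.collapsedEdges.connectedComponentMk a =
          T.collapsedEdges.connectedComponentMk b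
        · rw [he]; exact ih
        · exact (Adj.reachable (G := T.collapse.graph) ⟨he, a, b, rfl, rfl, hadj⟩).trans ih
    obtain ⟨x⟩ := hT.1.1.nonempty
    have : Nonempty T.collapse.V := ⟨T.collapsedEdges.connectedComponentMk x⟩
    refine ⟨fun C D => ?_⟩
    induction C using ConnectedComponent.ind with
    | _ p =>
      induction D using ConnectedComponent.ind with
      | _ q =>
        obtain ⟨w⟩ := hT.1.1.preconnected p q
        exact hwalk w
  · refine isAcyclic_of_separating ?_
    rintro _ _ ⟨hne, x, y, rfl, rfl, hadj⟩
    obtain ⟨A, h1, h2, hA⟩ := exists_separating_components hT.1 hadj hne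
    refine ⟨A, h1, h2, ?_⟩
    rintro _ _ ⟨-, x', y', rfl, rfl, hadj'⟩ hne' h3
    refine hA x' y' hadj' (fun he => hne' ?_) h3
    rcases Sym2.eq_iff.1 he with ⟨rfl, rfl⟩ | ⟨rfl, rfl⟩
    · rfl
    · exact Sym2.eq_swap
  · rintro g _ _ ⟨hne, x, y, rfl, rfl, hadj⟩ ⟨h1, h2⟩
    obtain ⟨h3, h4⟩ := eq_of_mk_eq hT.1 hadj (T.smul_adj g hadj.symm) hne h2 h1
    exact hT.2 g x y hadj ⟨h4, h3⟩
  · intro e he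
    induction e with
    | h C D =>
      obtain ⟨hne, x, y, rfl, rfl, hadj⟩ := he
      -- An element fixing both components fixes the only edge joining them.
      have hE : T.collapse.edgeStab s((T.collapsedEdges.connectedComponentMk x : T.collapse.V),
          (T.collapsedEdges.connectedComponentMk y : T.collapse.V)) = T.edgeStab s(x, y) := by
        ext g
        refine mem_edgeStab.trans (Iff.trans ?_ mem_edgeStab.symm)
        constructor
        · rintro ⟨h1, h2⟩
          exact eq_of_mk_eq hT.1 hadj (T.smul_adj g hadj) hne h1 h2
        · rintro ⟨h1, h2⟩
          exact ⟨congrArg T.collapsedEdges.connectedComponentMk h1,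
            congrArg T.collapsedEdges.connectedComponentMk h2⟩
      rw [hE]
      exact isInfiniteCyclic_of_mk_ne hadj hne

/-! ### Components of the collapsed edges of the tree of cylinders -/

theorem smul_inl_eq {g : G} {x : T.BoundaryVertex} :
    g • (Sum.inl x : T.treeOfCylinders.V) = Sum.inl x ↔ g • x.1 = x.1 := by
  change (Sum.inl (g • x) : T.treeOfCylinders.V) = Sum.inl x ↔ _
  rw [Sum.inl.injEq]
  exact Subtype.ext_iff

theorem smul_inr_eq {g : G} {Y : T.Cylinder} :
    g • (Sum.inr Y : T.treeOfCylinders.V) = Sum.inr Y ↔ g • Y = Y := by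
  change (Sum.inr (g • Y) : T.treeOfCylinders.V) = Sum.inr Y ↔ _
  rw [Sum.inr.injEq]

theorem vertexStab_inl (x : T.BoundaryVertex) :
    T.treeOfCylinders.vertexStab (Sum.inl x : T.treeOfCylinders.V) = T.vertexStab x.1 := by
  ext g
  exact smul_inl_eq

theorem vertexStab_inr (Y : T.Cylinder) :
    T.treeOfCylinders.vertexStab (Sum.inr Y : T.treeOfCylinders.V) = MulAction.stabilizer G Y := by
  ext g
  exact smul_inr_eq

theorem edgeStab_treeOfCylinders (x : T.BoundaryVertex) (Y : T.Cylinder) :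
    T.treeOfCylinders.edgeStab s((Sum.inl x : T.treeOfCylinders.V), (Sum.inr Y)) =
      T.vertexStab x.1 ⊓ MulAction.stabilizer G Y := by
  ext g
  exact mem_edgeStab.trans (and_congr smul_inl_eq smul_inr_eq)

theorem edgeStab_treeOfCylinders' (x : T.BoundaryVertex) (Y : T.Cylinder) :
    T.treeOfCylinders.edgeStab s((Sum.inr Y : T.treeOfCylinders.V), (Sum.inl x)) =
      T.vertexStab x.1 ⊓ MulAction.stabilizer G Y :=
  (congrArg T.treeOfCylinders.edgeStab Sym2.eq_swap).trans (edgeStab_treeOfCylinders x Y)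

theorem infinite_of_mem (htf : ∀ g : G, g ≠ 1 → ¬ IsOfFinOrder g) {K : Subgroup G} {g : G}
    (hg : g ∈ K) (hg1 : g ≠ 1) : Infinite K := by
  refine Infinite.of_injective (fun n : ℤ => (⟨g ^ n, K.zpow_mem hg n⟩ : K)) fun m n h => ?_
  have h1 : g ^ m = g ^ n := congrArg Subtype.val h
  by_contra hne
  refine zpow_ne_one_of_torsionFree htf hg1 (sub_ne_zero.2 hne) ?_
  rw [zpow_sub, h1, mul_inv_cancel]

theorem isInfiniteCyclic_iff_isCyclic (htf : ∀ g : G, g ≠ 1 → ¬ IsOfFinOrder g)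
    (hT : T.IsCyclicTree) {x : T.V} {Y : T.Cylinder} (hx : T.MemCylinder x Y) :
    IsInfiniteCyclic (T.vertexStab x ⊓ MulAction.stabilizer G Y) ↔
      IsCyclic (T.vertexStab x ⊓ MulAction.stabilizer G Y : Subgroup G) := by
  refine ⟨fun h => h.1, fun h => ⟨h, ?_⟩⟩
  obtain ⟨a, ha, hY⟩ := exists_generatesEdgeStab hT Y
  obtain ⟨n, hn, hnx⟩ := (memCylinder_iff hT htf ha hY).1 hx
  exact infinite_of_mem htf (g := a ^ n) ⟨hnx, (isVirtualNormalizer_stabilizer htf ha hY).mem_of_commute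
    ((Commute.refl a).zpow_left n)⟩ (zpow_ne_one_of_torsionFree htf ha hn)

theorem stabilizer_le_of_not_isCyclic (htf : ∀ g : G, g ≠ 1 → ¬ IsOfFinOrder g)
    (hct : IsCommutativeTransitive G) (hT : T.IsCyclicTree) {x : T.V} {Y : T.Cylinder}
    (hx : T.MemCylinder x Y)
    (hnc : ¬ IsCyclic (T.vertexStab x ⊓ MulAction.stabilizer G Y : Subgroup G)) :
    MulAction.stabilizer G Y ≤ T.vertexStab x := by
  obtain ⟨a, ha, hY⟩ := exists_generatesEdgeStab hT Y
  exact fun g hg => smul_eq_of_not_isCyclic htf hct (isVirtualNormalizer_stabilizer htf ha hY) ha hT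
    ((memCylinder_iff hT htf ha hY).1 hx) hnc hg

/-- At most one vertex of a cylinder gives a collapsed edge. -/
theorem eq_of_not_isCyclic (htf : ∀ g : G, g ≠ 1 → ¬ IsOfFinOrder g)
    (hct : IsCommutativeTransitive G) (hT : T.IsCyclicTree) {x x' : T.V} {Y : T.Cylinder}
    (hx : T.MemCylinder x Y) (hx' : T.MemCylinder x' Y)
    (hnc : ¬ IsCyclic (T.vertexStab x ⊓ MulAction.stabilizer G Y : Subgroup G))
    (hnc' : ¬ IsCyclic (T.vertexStab x' ⊓ MulAction.stabilizer G Y : Subgroup G)) : x = x' := by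
  by_contra hne
  have h1 := stabilizer_le_of_not_isCyclic htf hct hT hx hnc
  have h2 := stabilizer_le_of_not_isCyclic htf hct hT hx' hnc'
  exact hnc (isCyclic_of_fixes hT hne (fun g hg => hg.1) (fun g hg => h2 hg.2))

theorem collapsedEdges_adj_iff (htf : ∀ g : G, g ≠ 1 → ¬ IsOfFinOrder g)
    (hT : T.IsCyclicTree) {a b : T.treeOfCylinders.V} :
    T.treeOfCylinders.collapsedEdges.Adj a b ↔ ∃ (x : T.BoundaryVertex) (Y : T.Cylinder),
      T.MemCylinder x.1 Y ∧
      ¬ IsCyclic (T.vertexStab x.1 ⊓ MulAction.stabilizer G Y : Subgroup G) ∧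
      ((a = Sum.inl x ∧ b = Sum.inr Y) ∨ (a = Sum.inr Y ∧ b = Sum.inl x)) := by
  constructor
  · rintro ⟨⟨x, Y, hx, ⟨rfl, rfl⟩ | ⟨rfl, rfl⟩⟩, hnc⟩
    · rw [edgeStab_treeOfCylinders, isInfiniteCyclic_iff_isCyclic htf hT hx] at hnc
      exact ⟨x, Y, hx, hnc, Or.inl ⟨rfl, rfl⟩⟩
    · rw [edgeStab_treeOfCylinders', isInfiniteCyclic_iff_isCyclic htf hT hx] at hnc
      exact ⟨x, Y, hx, hnc, Or.inr ⟨rfl, rfl⟩⟩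
  · rintro ⟨x, Y, hx, hnc, ⟨rfl, rfl⟩ | ⟨rfl, rfl⟩⟩
    · refine ⟨⟨x, Y, hx, Or.inl ⟨rfl, rfl⟩⟩, ?_⟩
      rwa [edgeStab_treeOfCylinders, isInfiniteCyclic_iff_isCyclic htf hT hx]
    · refine ⟨⟨x, Y, hx, Or.inr ⟨rfl, rfl⟩⟩, ?_⟩
      rwa [edgeStab_treeOfCylinders', isInfiniteCyclic_iff_isCyclic htf hT hx]

/-- The component of a boundary vertex contains no other boundary vertex. -/
theorem boundaryVertex_eq_of_mk_eq (htf : ∀ g : G, g ≠ 1 → ¬ IsOfFinOrder g)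
    (hct : IsCommutativeTransitive G) (hT : T.IsCyclicTree) {x x' : T.BoundaryVertex}
    (h : T.treeOfCylinders.collapsedEdges.connectedComponentMk (Sum.inl x : T.treeOfCylinders.V) =
      T.treeOfCylinders.collapsedEdges.connectedComponentMk (Sum.inl x' : T.treeOfCylinders.V)) :
    x = x' := by
  -- The star formed by `x` and the cylinders joined to it by collapsed edges; it is closed under
  -- adjacency, since a cylinder has at most one collapsed edge.
  let P : T.treeOfCylinders.V → Prop := fun z => z = Sum.inl x ∨ ∃ Y : T.Cylinder, z = Sum.inr Y ∧
    T.MemCylinder x.1 Y ∧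
    ¬ IsCyclic (T.vertexStab x.1 ⊓ MulAction.stabilizer G Y : Subgroup G)
  have hwalk : ∀ {p q : T.treeOfCylinders.V}, T.treeOfCylinders.collapsedEdges.Walk p q →
      P p → P q := by
    intro p q w
    induction w with
    | nil => exact id
    | cons hadj w ih =>
      intro hp
      apply ih
      obtain ⟨z, Y, hz, hnc, ⟨rfl, rfl⟩ | ⟨rfl, rfl⟩⟩ := (collapsedEdges_adj_iff htf hT).1 hadj
      · rcases hp with h1 | ⟨Y', h1, -⟩
        · obtain rfl : z = x := Sum.inl.inj h1
          exact Or.inr ⟨Y, rfl, hz, hnc⟩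
        · exact absurd h1 (by rintro ⟨⟩)
      · rcases hp with h1 | ⟨Y', h1, h2, h3⟩
        · exact absurd h1 (by rintro ⟨⟩)
        · obtain rfl : Y = Y' := Sum.inr.inj h1
          obtain rfl : z = x := Subtype.ext (eq_of_not_isCyclic htf hct hT hz h2 hnc h3)
          exact Or.inl rfl
  obtain ⟨w⟩ := ConnectedComponent.eq.1 h
  rcases hwalk w (Or.inl rfl) with h1 | ⟨Y, h1, -⟩
  · exact (Sum.inl.inj h1).symm
  · exact absurd h1 (by rintro ⟨⟩)

/-- A cylinder without collapsed edges is alone in its component. -/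
theorem eq_of_mk_eq_cylinder (htf : ∀ g : G, g ≠ 1 → ¬ IsOfFinOrder g) (hT : T.IsCyclicTree)
    {Y : T.Cylinder} (hY : ∀ x : T.BoundaryVertex, T.MemCylinder x.1 Y →
      IsCyclic (T.vertexStab x.1 ⊓ MulAction.stabilizer G Y : Subgroup G))
    {z : T.treeOfCylinders.V}
    (h : T.treeOfCylinders.collapsedEdges.connectedComponentMk (Sum.inr Y : T.treeOfCylinders.V) =
      T.treeOfCylinders.collapsedEdges.connectedComponentMk z) : z = Sum.inr Y := by
  obtain ⟨w⟩ := ConnectedComponent.eq.1 h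
  cases w with
  | nil => rfl
  | cons hadj w =>
    obtain ⟨x, Y', hx, hnc, ⟨h1, -⟩ | ⟨h1, -⟩⟩ := (collapsedEdges_adj_iff htf hT).1 hadj
    · exact absurd h1 (by rintro ⟨⟩)
    · obtain rfl : Y = Y' := Sum.inr.inj h1
      exact absurd (hY x hx) hnc

theorem collapsed_vertexStab_inl (htf : ∀ g : G, g ≠ 1 → ¬ IsOfFinOrder g)
    (hct : IsCommutativeTransitive G) (hT : T.IsCyclicTree) (x : T.BoundaryVertex) :
    T.collapsedTreeOfCylinders.vertexStab (T.treeOfCylinders.collapsedEdges.connectedComponentMk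
      (Sum.inl x : T.treeOfCylinders.V) : T.collapsedTreeOfCylinders.V) = T.vertexStab x.1 := by
  ext g
  constructor
  · intro h
    have h1 : g • x = x := boundaryVertex_eq_of_mk_eq htf hct hT h
    exact congrArg Subtype.val h1
  · intro h
    have h1 := smul_inl_eq.2 h
    change T.treeOfCylinders.collapsedEdges.connectedComponentMk
      (g • (Sum.inl x : T.treeOfCylinders.V)) = _
    rw [h1]

theorem collapsed_vertexStab_inr (htf : ∀ g : G, g ≠ 1 → ¬ IsOfFinOrder g)
    (hT : T.IsCyclicTree) {Y : T.Cylinder} (hY : ∀ x : T.BoundaryVertex, T.MemCylinder x.1 Y →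
      IsCyclic (T.vertexStab x.1 ⊓ MulAction.stabilizer G Y : Subgroup G)) :
    T.collapsedTreeOfCylinders.vertexStab (T.treeOfCylinders.collapsedEdges.connectedComponentMk
      (Sum.inr Y : T.treeOfCylinders.V) : T.collapsedTreeOfCylinders.V) =
      MulAction.stabilizer G Y := by
  ext g
  constructor
  · intro h
    exact smul_inr_eq.1 (eq_of_mk_eq_cylinder htf hT hY (Eq.symm h))
  · intro h
    have h1 := smul_inr_eq.2 h
    change T.treeOfCylinders.collapsedEdges.connectedComponentMk
      (g • (Sum.inr Y : T.treeOfCylinders.V)) = _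
    rw [h1]

/-- Each vertex of the collapsed tree comes from a boundary vertex, or from a cylinder without
collapsed edges. -/
theorem exists_center (htf : ∀ g : G, g ≠ 1 → ¬ IsOfFinOrder g) (hT : T.IsCyclicTree)
    (C : T.collapsedTreeOfCylinders.V) :
    (∃ x : T.BoundaryVertex, C = T.treeOfCylinders.collapsedEdges.connectedComponentMk
      (Sum.inl x : T.treeOfCylinders.V)) ∨
    ∃ Y : T.Cylinder, C = T.treeOfCylinders.collapsedEdges.connectedComponentMk
      (Sum.inr Y : T.treeOfCylinders.V) ∧ ∀ x : T.BoundaryVertex, T.MemCylinder x.1 Y →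
      IsCyclic (T.vertexStab x.1 ⊓ MulAction.stabilizer G Y : Subgroup G) := by
  induction C using ConnectedComponent.ind with
  | _ z =>
    rcases z with x | Y
    · exact Or.inl ⟨x, rfl⟩
    · by_cases h : ∀ x : T.BoundaryVertex, T.MemCylinder x.1 Y →
          IsCyclic (T.vertexStab x.1 ⊓ MulAction.stabilizer G Y : Subgroup G)
      · exact Or.inr ⟨Y, rfl, h⟩
      · push Not at h
        obtain ⟨x, hx, hnc⟩ := h
        refine Or.inl ⟨x, ConnectedComponent.eq.2 (Adj.reachable ?_)⟩
        exact (collapsedEdges_adj_iff htf hT).2 ⟨x, Y, hx, hnc, Or.inr ⟨rfl, rfl⟩⟩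

/-- Each component has a centre with the same stabilizer, so collapsing creates no elliptic
subgroup. -/
theorem sameDeformationSpace_collapsed (htf : ∀ g : G, g ≠ 1 → ¬ IsOfFinOrder g)
    (hct : IsCommutativeTransitive G) (hT : T.IsCyclicTree) :
    T.collapsedTreeOfCylinders.SameDeformationSpace T.treeOfCylinders := by
  intro H
  constructor
  · rintro ⟨C, hC⟩
    rcases exists_center htf hT C with ⟨x, rfl⟩ | ⟨Y, rfl, hY⟩
    · refine ⟨Sum.inl x, fun g hg => smul_inl_eq.2 ?_⟩
      have h1 : g ∈ T.collapsedTreeOfCylinders.vertexStab _ := hC g hg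
      rw [collapsed_vertexStab_inl htf hct hT] at h1
      exact h1
    · refine ⟨Sum.inr Y, fun g hg => smul_inr_eq.2 ?_⟩
      have h1 : g ∈ T.collapsedTreeOfCylinders.vertexStab _ := hC g hg
      rw [collapsed_vertexStab_inr htf hT hY] at h1
      exact h1
  · rintro ⟨z, hz⟩
    exact ⟨T.treeOfCylinders.collapsedEdges.connectedComponentMk z, fun g hg =>
      congrArg T.treeOfCylinders.collapsedEdges.connectedComponentMk (hz g hg)⟩

end ActionGraph

/-! ### Comparison of the vertex stabilizers of `T`, `T_c` and `T_c^*`. -/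

namespace ActionGraph

open SimpleGraph

variable {G : Type u} [Group G] {T : ActionGraph.{u, v} G}

theorem vertexStab_le_of_not_boundary {x : T.V} {Y : T.Cylinder} (hx : T.MemCylinder x Y)
    (hb : ¬ ∃ Y Y' : T.Cylinder, Y ≠ Y' ∧ T.MemCylinder x Y ∧ T.MemCylinder x Y') :
    T.vertexStab x ≤ MulAction.stabilizer G Y := by
  intro g hg
  have h1 := hx.smul g
  rw [show g • x = x from hg] at h1
  by_contra hne
  exact hb ⟨_, _, hne, h1, hx⟩

theorem IsElliptic.treeOfCylinders (hT : T.IsGTree) (hne : Nontrivial T.V) {H : Subgroup G}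
    (h : T.IsElliptic H) : T.treeOfCylinders.IsElliptic H := by
  obtain ⟨x, hx⟩ := h
  by_cases hb : ∃ Y Y' : T.Cylinder, Y ≠ Y' ∧ T.MemCylinder x Y ∧ T.MemCylinder x Y'
  · exact ⟨Sum.inl ⟨x, hb⟩, fun g hg => smul_inl_eq.2 (hx g hg)⟩
  · obtain ⟨Y, hY⟩ := exists_cylinder_of_mem hT hne x
    exact ⟨Sum.inr Y, fun g hg => smul_inr_eq.2 (vertexStab_le_of_not_boundary hY hb (hx g hg))⟩

theorem exists_le_or_isSolvableBS_stabilizer (hfg : Group.FG G)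
    (htf : ∀ g : G, g ≠ 1 → ¬ IsOfFinOrder g) (hct : IsCommutativeTransitive G)
    (hT : T.IsCyclicTree) (Y : T.Cylinder) :
    (∃ x, T.MemCylinder x Y ∧ MulAction.stabilizer G Y ≤ T.vertexStab x) ∨
      IsSolvableBS (MulAction.stabilizer G Y) := by
  obtain ⟨a, ha, hY⟩ := exists_generatesEdgeStab hT Y
  obtain ⟨x₀⟩ := hT.1.1.1.nonempty
  obtain ⟨v, -, hv⟩ := exists_mem_cylinder_ne Y x₀
  rcases exists_fixed_or_isSolvableBS hfg htf hct (isVirtualNormalizer_stabilizer htf ha hY) ha hT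
    ⟨v, (memCylinder_iff hT htf ha hY).1 hv⟩ with ⟨x, hx, h⟩ | h
  · exact Or.inl ⟨x, (memCylinder_iff hT htf ha hY).2 hx, h⟩
  · exact Or.inr h

/-- If `x` lies in a single cylinder `Y`, then `G_x` is contained in the stabilizer of `Y`, and
non-cyclicity gives the reverse inclusion. The non-boundary vertex `x` is the only one of `Y` with
non-cyclic intersection, so no edge at `Y` is collapsed. -/
theorem exists_vertexStab_eq (htf : ∀ g : G, g ≠ 1 → ¬ IsOfFinOrder g)
    (hct : IsCommutativeTransitive G) (hT : T.IsCyclicTree) (hne : Nontrivial T.V) {x : T.V}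
    (hx : ¬ IsCyclic (T.vertexStab x)) :
    (∃ y : T.treeOfCylinders.V, T.treeOfCylinders.vertexStab y = T.vertexStab x) ∧
      ∃ y : T.collapsedTreeOfCylinders.V,
        T.collapsedTreeOfCylinders.vertexStab y = T.vertexStab x := by
  by_cases hb : ∃ Y Y' : T.Cylinder, Y ≠ Y' ∧ T.MemCylinder x Y ∧ T.MemCylinder x Y'
  · let z : T.BoundaryVertex := ⟨x, hb⟩
    exact ⟨⟨_, vertexStab_inl z⟩, ⟨_, collapsed_vertexStab_inl htf hct hT z⟩⟩
  · obtain ⟨Y, hY⟩ := exists_cylinder_of_mem hT.1 hne x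
    have hle := vertexStab_le_of_not_boundary hY hb
    have hnc : ¬ IsCyclic (T.vertexStab x ⊓ MulAction.stabilizer G Y : Subgroup G) := by
      rwa [inf_eq_left.2 hle]
    have heq : MulAction.stabilizer G Y = T.vertexStab x :=
      le_antisymm (stabilizer_le_of_not_isCyclic htf hct hT hY hnc) hle
    refine ⟨⟨_, (vertexStab_inr Y).trans heq⟩, ⟨_, (collapsed_vertexStab_inr htf hT ?_).trans heq⟩⟩
    intro z hz
    by_contra hc
    have := eq_of_not_isCyclic htf hct hT hz hY hc hnc
    exact hb (this ▸ z.2)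

theorem exists_vertexStab_eq_or_isSolvableBS (hfg : Group.FG G)
    (htf : ∀ g : G, g ≠ 1 → ¬ IsOfFinOrder g) (hct : IsCommutativeTransitive G)
    (hT : T.IsCyclicTree) {y : T.collapsedTreeOfCylinders.V}
    (hy : ¬ IsCyclic (T.collapsedTreeOfCylinders.vertexStab y)) :
    (∃ x : T.V, T.vertexStab x = T.collapsedTreeOfCylinders.vertexStab y) ∨
      IsSolvableBS (T.collapsedTreeOfCylinders.vertexStab y) := by
  rcases exists_center htf hT y with ⟨x, rfl⟩ | ⟨Y, rfl, hY⟩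
  · exact Or.inl ⟨x.1, (collapsed_vertexStab_inl htf hct hT x).symm⟩
  · have hst := collapsed_vertexStab_inr htf hT hY
    rw [hst] at hy ⊢
    refine (exists_le_or_isSolvableBS_stabilizer hfg htf hct hT Y).imp_left ?_
    rintro ⟨x, hx, hle⟩
    have hb : ¬ ∃ Y Y' : T.Cylinder, Y ≠ Y' ∧ T.MemCylinder x Y ∧ T.MemCylinder x Y' := by
      intro hb
      have h1 : IsCyclic (T.vertexStab x ⊓ MulAction.stabilizer G Y : Subgroup G) :=
        hY ⟨x, hb⟩ hx
      rw [inf_eq_right.2 hle] at h1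
      exact hy h1
    exact ⟨x, le_antisymm (vertexStab_le_of_not_boundary hx hb) hle⟩

/-! ### Solvable Baumslag–Solitar subgroups -/

/-- If `c` fixes two vertices, then the elements virtually normalizing `⟨c⟩` preserve a
cylinder. -/
theorem exists_cylinder_smul_eq (htf : ∀ g : G, g ≠ 1 → ¬ IsOfFinOrder g) (hT : T.IsCyclicTree)
    {c : G} (hc : c ≠ 1) {u v : T.V} (huv : u ≠ v) (hu : c • u = u) (hv : c • v = v) :
    ∃ Y : T.Cylinder, ∀ (g : G) (m n : ℤ), m ≠ 0 → n ≠ 0 → g * c ^ m * g⁻¹ = c ^ n →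
      g • Y = Y := by
  obtain ⟨z, hz, hd⟩ := hT.1.1.exists_adj_closer huv
  have hb : T.graph.Btw u z v := by
    have : T.graph.dist z v = 1 := dist_eq_one_iff_adj.2 hz.symm
    unfold SimpleGraph.Btw
    omega
  obtain ⟨b, hb1, hgen⟩ := exists_edge_generator hT ⟨s(v, z), hz⟩
  have hcE : c ∈ T.edgeStab s(v, z) := mem_edgeStab.2 ⟨hv, smul_eq_of_btw hT.1.1 hu hv hb⟩
  obtain ⟨k, hk⟩ : c ∈ Subgroup.zpowers b := by rw [← hgen]; exact hcE
  simp only at hk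
  have hk0 : k ≠ 0 := by
    rintro rfl
    exact hc (by simpa using hk.symm)
  let Y : T.Cylinder := Quotient.mk T.cylinderSetoid ⟨s(v, z), hz⟩
  refine ⟨Y, fun g m n hm hn h => ?_⟩
  refine (isVirtualNormalizer_stabilizer htf hb1 (Y := Y) ⟨_, rfl, hgen⟩ g).2
    ⟨k * m, k * n, mul_ne_zero hk0 hm, mul_ne_zero hk0 hn, ?_⟩
  rw [zpow_mul, zpow_mul, hk, h]

/-- An element with an axis is not conjugate to one of its powers of exponent at least `2`. -/
theorem natAbs_le_one_of_conj (hT : T.graph.IsTree) {a t : G} {s : ℤ} (h : t * a * t⁻¹ = a ^ s)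
    {y : T.V} (hne : a • y ≠ y) (hb : T.graph.Btw y (a • y) (a • a • y)) : s.natAbs ≤ 1 := by
  have hpos : 0 < T.graph.dist y (a • y) := hT.dist_pos hne.symm
  have hz : ∀ n : ℤ, T.graph.dist y (a ^ n • y) = n.natAbs * T.graph.dist y (a • y) := by
    intro n
    rcases Int.natAbs_eq n with h1 | h1
    · conv_lhs => rw [h1, zpow_natCast]
      exact (dist_pow_smul hT hne hb _).1
    · conv_lhs => rw [h1, zpow_neg, zpow_natCast]
      rw [← dist_smul hT (a ^ n.natAbs), smul_inv_smul, dist_comm]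
      exact (dist_pow_smul hT hne hb _).1
  set D := T.graph.dist y (t • y) with hD
  -- The element `a ^ (s * n)` moves `t • y` by `n` translation lengths of `a` and `y` by `|s| * n`
  -- of them; the two displacements differ by at most `2 * D`.
  set n := 2 * D + 1 with hn
  have h1 : T.graph.dist (t • y) (a ^ (s * n) • t • y) = n * T.graph.dist y (a • y) := by
    rw [zpow_mul, ← h, conj_zpow, mul_smul, inv_smul_smul, mul_smul, dist_smul hT, hz,
      Int.natAbs_natCast]
  have h2 := hz (s * n)
  have h3 := hT.tri y (t • y) (a ^ (s * n) • y)
  have h4 := hT.tri (t • y) (a ^ (s * n) • t • y) (a ^ (s * n) • y)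
  rw [dist_smul hT, dist_comm (u := t • y) (v := y)] at h4
  rw [Int.natAbs_mul, Int.natAbs_natCast] at h2
  by_contra hs
  have h5 : 2 * (n * T.graph.dist y (a • y)) ≤ s.natAbs * n * T.graph.dist y (a • y) := by
    rw [mul_assoc]
    exact Nat.mul_le_mul_right _ (by omega)
  have h6 : n ≤ n * T.graph.dist y (a • y) := Nat.le_mul_of_pos_right _ hpos
  omega

/-- If `a` fixes `x`, then `a ^ s` fixes `x` and `t • x`, so `H` fixes `x` or preserves a cylinder.
If `a` has an axis, then `s = 1`, and some non-trivial element of the abelian group `H` fixes two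
points of the axis. -/
theorem isElliptic_treeOfCylinders_of_isSolvableBS (htf : ∀ g : G, g ≠ 1 → ¬ IsOfFinOrder g)
    (hct : IsCommutativeTransitive G) (hT : T.IsCyclicTree) (hne : Nontrivial T.V)
    {H : Subgroup G} (hH : IsSolvableBS H) : T.treeOfCylinders.IsElliptic H := by
  obtain ⟨s, a, t, hs, -, -, ha, hrel, hclos, hindep⟩ := hH.exists_generators
  have hcyl : ∀ {c : G} (_ : c ≠ 1) {u v : T.V} (_ : u ≠ v) (_ : c • u = u) (_ : c • v = v)
      (_ : a * c * a⁻¹ = c) (n : ℤ) (_ : n ≠ 0) (_ : t * c * t⁻¹ = c ^ n),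
      T.treeOfCylinders.IsElliptic H := by
    intro c hc u v huv hu hv h1 n hn h2
    obtain ⟨Y, hY⟩ := exists_cylinder_smul_eq htf hT hc huv hu hv
    have hle : H ≤ MulAction.stabilizer G Y := by
      rw [← hclos, Subgroup.closure_le]
      rintro g (rfl | rfl)
      · exact hY _ 1 1 one_ne_zero one_ne_zero (by simpa using h1)
      · exact hY _ 1 n one_ne_zero hn (by simpa using h2)
    exact ⟨Sum.inr Y, fun g hg => smul_inr_eq.2 (hle hg)⟩
  by_cases hell : ∃ x : T.V, a • x = x
  · obtain ⟨x, hx⟩ := hell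
    by_cases htx : t • x = x
    · refine IsElliptic.treeOfCylinders hT.1 hne ⟨x, fun g hg => ?_⟩
      have hle : H ≤ MulAction.stabilizer G x := by
        rw [← hclos, Subgroup.closure_le]
        rintro g (rfl | rfl)
        · exact hx
        · exact htx
      exact hle hg
    · refine hcyl (c := a ^ s) (zpow_ne_one_of_torsionFree htf ha hs) (Ne.symm htx)
        (zpow_smul_eq hx s) ?_ (by group) s hs (by rw [← conj_zpow, hrel])
      rw [← hrel, mul_smul, mul_smul, inv_smul_smul, hx]
  · push Not at hell
    obtain ⟨y, -, hb⟩ := exists_axis hT.1 (S := Set.univ) (fun _ _ _ _ _ _ => trivial)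
      (Set.nonempty_iff_univ_nonempty.1 hT.1.1.1.nonempty) (h := a) (fun _ _ => trivial)
    have hs1 := natAbs_le_one_of_conj hT.1.1 hrel (hell y) hb
    have hcomm : Commute t a := by
      refine hct.commute_of_normalizes htf (by rw [hrel]; exact Subgroup.zpow_mem_zpowers a s) ?_
      have hss : s = 1 ∨ s = -1 := by omega
      have : t⁻¹ * a * t = a ^ s := by
        rcases hss with rfl | rfl
        · rw [zpow_one] at hrel ⊢
          conv_lhs => rw [← hrel]
          group
        · rw [zpow_neg_one] at hrel ⊢
          have h1 : a = t * a⁻¹ * t⁻¹ := by rw [← conj_inv, hrel, inv_inv]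
          conv_lhs => rw [h1]
          group
      rw [this]
      exact Subgroup.zpow_mem_zpowers a s
    have hs1' : s = 1 := by
      have h1 : a = a ^ s := by rw [← hrel, hcomm.eq, mul_inv_cancel_right]
      by_contra hne1
      refine zpow_ne_one_of_torsionFree htf ha (sub_ne_zero.2 hne1) ?_
      rw [zpow_sub, ← h1, zpow_one, mul_inv_cancel]
    obtain ⟨r, hr, -, -, hsh, hcent⟩ := exists_axis_ray hT.1.1 (hell y) hb
    have hpos : 0 < T.graph.dist y (a • y) := hT.1.1.dist_pos (hell y).symm
    obtain ⟨d, hd⟩ := hcent t hcomm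
    generalize T.graph.dist y (a • y) = l at hsh hpos
    -- The shifts of `a` and `t` are `l` and `d`, so they cancel in `a ^ d * (t ^ l)⁻¹`.
    have hc0 := (hsh.zpow d).mul (hd.zpow l).inv
    rw [mul_comm d, add_neg_cancel] at hc0
    obtain ⟨N, hN⟩ := hc0.eventually_fixed
    have hcx := hN N le_rfl
    have hca : Commute a (a ^ d * (t ^ (l : ℤ))⁻¹) :=
      ((Commute.refl a).zpow_right d).mul_right (hcomm.symm.zpow_right l).inv_right
    have hct' : Commute t (a ^ d * (t ^ (l : ℤ))⁻¹) :=
      (hcomm.zpow_right d).mul_right ((Commute.refl t).zpow_right l).inv_right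
    refine hcyl (c := a ^ d * (t ^ (l : ℤ))⁻¹) ?_ (hell (r N)) ?_ hcx ?_ 1 one_ne_zero ?_
    · intro h1
      have := hindep hs1' d l (mul_inv_eq_one.1 h1)
      omega
    · rw [← mul_smul, ← hca.eq, mul_smul, hcx]
    · rw [hca.eq, mul_inv_cancel_right]
    · rw [hct'.eq, mul_inv_cancel_right, zpow_one]

theorem sameDeformationSpace_treeOfCylinders_iff (hfg : Group.FG G)
    (htf : ∀ g : G, g ≠ 1 → ¬ IsOfFinOrder g) (hct : IsCommutativeTransitive G)
    (hT : T.IsCyclicTree) (hne : Nontrivial T.V) :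
    T.treeOfCylinders.SameDeformationSpace T ↔
      ∀ H : Subgroup G, IsSolvableBS H → T.IsElliptic H := by
  constructor
  · exact fun h H hH => (h H).1 (isElliptic_treeOfCylinders_of_isSolvableBS htf hct hT hne hH)
  · intro h H
    refine ⟨?_, IsElliptic.treeOfCylinders hT.1 hne⟩
    rintro ⟨x | Y, hx⟩
    · exact ⟨x.1, fun g hg => smul_inl_eq.1 (hx g hg)⟩
    · have hle : H ≤ MulAction.stabilizer G Y := fun g hg => smul_inr_eq.1 (hx g hg)
      rcases exists_le_or_isSolvableBS_stabilizer hfg htf hct hT Y with ⟨z, -, hz⟩ | hBS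
      · exact ⟨z, fun g hg => hz (hle hg)⟩
      · obtain ⟨z, hz⟩ := h _ hBS
        exact ⟨z, fun g hg => hz g (hle hg)⟩

/-! ### Acylindricity -/

theorem exists_cylinder_of_fixes_edge (htf : ∀ g : G, g ≠ 1 → ¬ IsOfFinOrder g)
    (hT : T.IsCyclicTree) (hne : Nontrivial T.V) {C D : T.collapsedTreeOfCylinders.V}
    (hCD : T.collapsedTreeOfCylinders.graph.Adj C D) {g : G} (hg : g ≠ 1) (hC : g • C = C)
    (hD : g • D = D) : ∃ (Y : T.Cylinder) (b : G), b ≠ 1 ∧ T.GeneratesEdgeStab Y b ∧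
      (∃ m n : ℤ, m ≠ 0 ∧ n ≠ 0 ∧ g ^ m = b ^ n) ∧
      (T.treeOfCylinders.collapsedEdges.connectedComponentMk (Sum.inr Y : T.treeOfCylinders.V) = C ∨
        T.treeOfCylinders.collapsedEdges.connectedComponentMk (Sum.inr Y : T.treeOfCylinders.V)
          = D) := by
  obtain ⟨hneCD, p, q, rfl, rfl, hpq⟩ := hCD
  have hfix := eq_of_mk_eq (isGTree_treeOfCylinders htf hT hne).1 hpq
    (T.treeOfCylinders.smul_adj g hpq) hneCD hC hD
  have hcyc := isInfiniteCyclic_of_mk_ne hpq hneCD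
  obtain ⟨x, Y, hx, hor⟩ := id hpq
  obtain ⟨b, hb, hY⟩ := exists_generatesEdgeStab hT Y
  have hkey : IsCyclic (T.vertexStab x.1 ⊓ MulAction.stabilizer G Y : Subgroup G) ∧
      g ∈ T.vertexStab x.1 ⊓ MulAction.stabilizer G Y := by
    rcases hor with ⟨rfl, rfl⟩ | ⟨rfl, rfl⟩
    · rw [edgeStab_treeOfCylinders] at hcyc
      exact ⟨hcyc.1, smul_inl_eq.1 hfix.1, smul_inr_eq.1 hfix.2⟩
    · rw [edgeStab_treeOfCylinders'] at hcyc
      exact ⟨hcyc.1, smul_inl_eq.1 hfix.2, smul_inr_eq.1 hfix.1⟩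
  obtain ⟨k, hk, hkx⟩ := (memCylinder_iff hT htf hb hY).1 hx
  obtain ⟨m, n, hm, hn, hmn⟩ := exists_zpow_eq_zpow_of_isCyclic hkey.1 hkey.2 (y := b ^ k)
    ⟨hkx, (isVirtualNormalizer_stabilizer htf hb hY).mem_of_commute
      ((Commute.refl b).zpow_left k)⟩ hg (zpow_ne_one_of_torsionFree htf hb hk)
  refine ⟨Y, b, hb, hY, ⟨m, k * n, hm, mul_ne_zero hk hn, by rw [hmn, zpow_mul]⟩, ?_⟩
  rcases hor with ⟨rfl, rfl⟩ | ⟨rfl, rfl⟩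
  · exact Or.inr rfl
  · exact Or.inl rfl

theorem isAcylindricalWith_two (htf : ∀ g : G, g ≠ 1 → ¬ IsOfFinOrder g)
    (hT : T.IsCyclicTree) (hne : Nontrivial T.V) :
    T.collapsedTreeOfCylinders.IsAcylindricalWith 2 := by
  have hS : T.collapsedTreeOfCylinders.IsCyclicTree :=
    isCyclicTree_collapse (isGTree_treeOfCylinders htf hT hne)
  intro C D hCD g hC hD
  by_contra hg
  obtain ⟨z₁, hz₁, hd₁⟩ := hS.1.1.exists_btw C (y := D) (k := 1) (by omega)
  obtain ⟨z₂, hz₂, hd₂⟩ := hS.1.1.exists_btw C (y := D) (k := 2) (by omega)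
  obtain ⟨z₃, hz₃, hd₃⟩ := hS.1.1.exists_btw C (y := D) (k := 3) (by omega)
  have hadj : T.collapsedTreeOfCylinders.graph.Adj z₂ z₃ := by
    rw [← dist_eq_one_iff_adj]
    have := (hS.1.1.btw_of_le hz₃ hz₂ (by omega)).1
    unfold SimpleGraph.Btw at this
    omega
  obtain ⟨Y, b, hb, hY, ⟨m, n, hm, hn, hmn⟩, hor⟩ := exists_cylinder_of_fixes_edge htf hT hne
    (dist_eq_one_iff_adj.1 hd₁) hg hC (smul_eq_of_btw hS.1.1 hC hD hz₁)
  obtain ⟨Y', b', hb', hY', ⟨m', n', hm', hn', hmn'⟩, hor'⟩ := exists_cylinder_of_fixes_edge htf hT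
    hne hadj hg (smul_eq_of_btw hS.1.1 hC hD hz₂) (smul_eq_of_btw hS.1.1 hC hD hz₃)
  have hYY' : Y = Y' := by
    refine (generates_eq_iff htf hb hY hY').2
      ⟨n * m', n' * m, mul_ne_zero hn hm', mul_ne_zero hn' hm, ?_⟩
    rw [zpow_mul, zpow_mul, ← hmn, ← hmn', ← zpow_mul, ← zpow_mul, mul_comm]
  subst hYY'
  have h0 : T.collapsedTreeOfCylinders.graph.dist C C = 0 := dist_self
  -- The cylinder would be a common end of the first and third edges of a geodesic.
  rcases hor with h | h <;> rcases hor' with h' | h' <;> rw [h] at h' <;> subst h' <;> omega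

/-! ### Domination -/

/-- Choose images of orbit representatives fixed by their stabilizers, and extend equivariantly. -/
theorem dominates_of_isElliptic {S : ActionGraph.{u, v} G} {T' : ActionGraph.{u, w} G}
    (h : ∀ y : S.V, T'.IsElliptic (S.vertexStab y)) : S.Dominates T' := by
  choose p hp using h
  let ρ : S.V → S.V := fun y => (Quotient.mk (MulAction.orbitRel G S.V) y).out
  have hρ : ∀ y, ∃ g : G, g • ρ y = y := fun y => by
    have h1 : (MulAction.orbitRel G S.V).r (ρ y) y := Quotient.exact (Quotient.out_eq _)
    obtain ⟨g, hg⟩ := h1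
    exact ⟨g⁻¹, by rw [inv_smul_eq_iff]; exact hg.symm⟩
  have hρ' : ∀ (g : G) y, ρ (g • y) = ρ y := fun g y => by
    have : Quotient.mk (MulAction.orbitRel G S.V) (g • y) =
      Quotient.mk (MulAction.orbitRel G S.V) y := Quotient.sound ⟨g, rfl⟩
    simp only [ρ, this]
  choose γ hγ using hρ
  refine ⟨fun y => γ y • p (ρ y), fun g y => ?_⟩
  have h1 := hp (ρ y) ((g * γ y)⁻¹ * γ (g • y)) (by
    have h2 := hγ (g • y)
    rw [hρ'] at h2
    rw [MulAction.mem_stabilizer_iff, mul_smul, h2, inv_smul_eq_iff, mul_smul, hγ])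
  rw [mul_smul, inv_smul_eq_iff, mul_smul] at h1
  simp only [hρ']
  exact h1

/-- Only stabilizers of cylinders need care. Any two vertices of `virtualFix a` in `T'` are fixed by
a common non-trivial power of `a`, so acylindricity bounds this invariant convex set, which is
non-empty because `T` dominates `T'`. -/
theorem dominates_of_isAcylindrical (htf : ∀ g : G, g ≠ 1 → ¬ IsOfFinOrder g)
    (hct : IsCommutativeTransitive G) (hT : T.IsCyclicTree) {T' : ActionGraph.{u, w} G}
    (hT' : T'.IsGTree) (hac : T'.IsAcylindrical) (hdom : T.Dominates T') :
    T.collapsedTreeOfCylinders.Dominates T' := by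
  obtain ⟨f, hf⟩ := hdom
  obtain ⟨k, hk⟩ := hac
  refine dominates_of_isElliptic fun C => ?_
  rcases exists_center htf hT C with ⟨x, rfl⟩ | ⟨Y, rfl, hY⟩
  · rw [collapsed_vertexStab_inl htf hct hT]
    exact ⟨f x.1, fun g hg => by rw [← hf, show g • x.1 = x.1 from hg]⟩
  · rw [collapsed_vertexStab_inr htf hT hY]
    obtain ⟨a, ha, hYa⟩ := exists_generatesEdgeStab hT Y
    have hN := isVirtualNormalizer_stabilizer htf ha hYa
    obtain ⟨x₀⟩ := hT.1.1.1.nonempty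
    obtain ⟨v, -, hv⟩ := exists_mem_cylinder_ne Y x₀
    obtain ⟨n, hn, hnv⟩ := (memCylinder_iff hT htf ha hYa).1 hv
    obtain ⟨z, -, hz⟩ := exists_fixed_of_bounded hT' (gconvex_virtualFix hT'.1 a)
      ⟨f v, n, hn, by rw [← hf, hnv]⟩ (fun g hg x hx => hN.smul_mem hg hx) (k := k) (by
        intro x hx y hy
        by_contra hlt
        obtain ⟨m, hm, hmx, hmy⟩ := exists_common_zpow_fixing hx hy
        exact zpow_ne_one_of_torsionFree htf ha hm (hk x y (by omega) _ hmx hmy))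
    exact ⟨z, hz⟩

end ActionGraph

theorem theorem3 {G : Type u} [Group G] (hfg : Group.FG G)
    (htf : ∀ g : G, g ≠ 1 → ¬ IsOfFinOrder g) (hct : IsCommutativeTransitive G)
    (T : ActionGraph.{u, v} G) (hT : T.IsCyclicTree) (hne : Nontrivial T.V) :
    -- `T_c` is a tree and `T_c^*` is a tree with infinite cyclic edge stabilizers
    (T.treeOfCylinders.IsGTree ∧ T.collapsedTreeOfCylinders.IsCyclicTree) ∧
    -- `T_c^*` and `T_c` are in the same deformation space
    T.collapsedTreeOfCylinders.SameDeformationSpace T.treeOfCylinders ∧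
    -- non-cyclic vertex stabilizers of `T` are vertex stabilizers of `T_c` and `T_c^*`
    (∀ x : T.V, ¬ IsCyclic (T.vertexStab x) →
      (∃ y : T.treeOfCylinders.V, T.treeOfCylinders.vertexStab y = T.vertexStab x) ∧
      (∃ y : T.collapsedTreeOfCylinders.V,
        T.collapsedTreeOfCylinders.vertexStab y = T.vertexStab x)) ∧
    -- the other non-cyclic vertex stabilizers of `T_c^*` are solvable Baumslag–Solitar groups
    (∀ y : T.collapsedTreeOfCylinders.V, ¬ IsCyclic (T.collapsedTreeOfCylinders.vertexStab y) →
      (∃ x : T.V, T.vertexStab x = T.collapsedTreeOfCylinders.vertexStab y) ∨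
      IsSolvableBS (T.collapsedTreeOfCylinders.vertexStab y)) ∧
    -- solvable Baumslag–Solitar subgroups are elliptic in `T_c` and `T_c^*`
    (∀ H : Subgroup G, IsSolvableBS H →
      T.treeOfCylinders.IsElliptic H ∧ T.collapsedTreeOfCylinders.IsElliptic H) ∧
    -- `T_c`, resp. `T_c^*`, is in the deformation space of `T` if and only if
    -- all solvable Baumslag–Solitar subgroups are elliptic in `T`
    (T.treeOfCylinders.SameDeformationSpace T ↔
      ∀ H : Subgroup G, IsSolvableBS H → T.IsElliptic H) ∧
    (T.collapsedTreeOfCylinders.SameDeformationSpace T ↔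
      ∀ H : Subgroup G, IsSolvableBS H → T.IsElliptic H) ∧
    -- acylindricity and maximality of `T_c^*`
    T.collapsedTreeOfCylinders.IsAcylindricalWith 2 ∧
    (∀ T' : ActionGraph.{u, w} G, T'.IsCyclicTree → T'.IsAcylindrical → T.Dominates T' →
      T.collapsedTreeOfCylinders.Dominates T') := by
  have hS := ActionGraph.sameDeformationSpace_collapsed htf hct hT
  have hiff := ActionGraph.sameDeformationSpace_treeOfCylinders_iff hfg htf hct hT hne
  refine ⟨⟨ActionGraph.isGTree_treeOfCylinders htf hT hne,
      ActionGraph.isCyclicTree_collapse (ActionGraph.isGTree_treeOfCylinders htf hT hne)⟩, hS,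
    fun x hx => ActionGraph.exists_vertexStab_eq htf hct hT hne hx,
    fun y hy => ActionGraph.exists_vertexStab_eq_or_isSolvableBS hfg htf hct hT hy,
    fun H hH => ?_, hiff, ?_,
    ActionGraph.isAcylindricalWith_two htf hT hne,
    fun T' hT' hac hdom => ActionGraph.dominates_of_isAcylindrical htf hct hT hT'.1 hac hdom⟩
  · have h := ActionGraph.isElliptic_treeOfCylinders_of_isSolvableBS htf hct hT hne hH
    exact ⟨h, (hS H).2 h⟩
  · exact Iff.trans (forall_congr' fun H => by rw [hS H]) hiff
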